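/- Let $n\ge 0$, $d=2^n$, and let $\{L_{j}\}_{j=1}^{K}$ (signal) and $\{L_k\}_{k=K+1}^{K+N}$ (noise) be pairwise different non-identity $n$-qubit Pauli operators (tensor products of $I,\sigma_x,\sigma_y,\sigma_z$). Let the noise decay rates be $\gamma_k>0$, let $T>0$ be the total time, and let the state of the qubits obey $$\dot\rho=\theta^2\sum_{j=1}^{K}\mathcal L_j(\rho)+\sum_{k=K+1}^{K+N}\gamma_k\mathcal L_k(\rho),\qquad \mathcal L_j(\rho)=L_j\rho L_j^\dagger-\tfrac12\{L_j^\dagger L_j,\rho\},$$ where $\theta=\sqrt{\gamma_1}>0$ is to be estimated. The classical Fisher information (CFI) of outcome probabilities $p_x(\theta)$ is $\sum_{x:\,p_x(\theta)\ne0}(\partial_\theta p_x)^2/p_x$; the quantum Fisher information (QFI) of a strategy is the supremum of the CFI over the allowed measurements. In an extended strategy the operators act as $L\otimes I$ on the qubits and a noiseless finite-dimensional ancilla. An extended sequential strategy with $M$ steps starts from any joint state, alternates $M$ times the evolution for time $T/M$ with an arbitrary control channel on qubits and ancilla, and ends with any measurement (POVM); its optimal QFI is the supremum over ancillae, states, controls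 and measurements. An extended measure-and-reset strategy with state $|\psi\rangle$ consists of $M$ independent rounds: prepare $|\psi\rangle$, evolve for time $T/M$, and perform one and the same measurement. All Fisher informations are taken in the limit of fast control, $M\to\infty$ at fixed $\theta$, followed by the vanishing-signal limit $\theta\to0^+$. For every Bell state $|\psi\rangle=d^{-1/2}\sum_{j=1}^{d}|e_j\rangle\otimes|e_j\rangle$, with $\{|e_j\rangle\}$ an orthonormal basis of $(\mathbb C^2)^{\otimes n}$: 1. The optimal QFI of the extended sequential strategies in the noiseless case ($N=0$) is $4KT$, and it equals $4T\max_{|\varphi\rangle}\sum_{j=1}^{K}\bigl(\langle\varphi|L_j^\dagger L_j|\varphi\rangle-|\langle\varphi|L_j|\varphi\rangle|^2\bigr)$, the maximum being over unit vectors of the qubits with any finite-dimensional ancilla. 2. In the presence of the noise, the extended measure-and-reset strategy with the Bell state recovers this value: its QFI is $4KT$. It is already attained by the two-outcome measurement $\{\Pi,I-\Pi\}$, where $\Pi$ is the projection onto $\mathrm{span}\{|\psi\rangle,(L_k\otimes I)|\psi\rangle: K<k\le K+N\}$, and $4T\sum_{j=1}^{K}\langle\psi|(L_j\otimes I)^\dagger(I-\Pi)(L_j\otimes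 I)|\psi\rangle=4KT$. 3. The Bell state and its images $(P\otimes I)|\psi\rangle$ under the $4^n-1$ non-identity $n$-qubit Pauli operators $P$ are pairwise orthogonal unit vectors. -/

import Mathlib

open scoped ComplexOrder Matrix Kronecker ENNReal InnerProductSpace Topology
open Filter

noncomputable section

/-! ### Lindblad evolution -/

section Lindblad

variable {d : Type*} [Fintype d] [DecidableEq d]

/-- The Lindblad superoperator `ρ ↦ L ρ L† - (L†L ρ + ρ L†L)/2` of a jump operator `L`. -/
def dissipator (L : Matrix d d ℂ) : Module.End ℂ (Matrix d d ℂ) :=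
  LinearMap.mulLeft ℂ L ∘ₗ LinearMap.mulRight ℂ Lᴴ
    - (1 / 2 : ℂ) • (LinearMap.mulLeft ℂ (Lᴴ * L) + LinearMap.mulRight ℂ (Lᴴ * L))

/-- The generator of the master equation (without Hamiltonian) with signal jump operators `Ls`,
common signal decay rate `θ ^ 2`, noise jump operators `Ln` and noise decay rates `γ`. The
parameter to be estimated is `θ`, the square root of the signal decay rate. -/
def generator {ι κ : Type*} [Fintype ι] [Fintype κ] (Ls : ι → Matrix d d ℂ)
    (Ln : κ → Matrix d d ℂ) (γ : κ → ℝ) (θ : ℝ) : Module.End ℂ (Matrix d d ℂ) :=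
  ((θ ^ 2 : ℝ) : ℂ) • ∑ j, dissipator (Ls j) + ∑ k, ((γ k : ℝ) : ℂ) • dissipator (Ln k)

/-- The solution `exp (t 𝓛) ρ` at time `t` of `dρ/dt = 𝓛 ρ` with initial value `ρ`. -/
def evolve (𝓛 : Module.End ℂ (Matrix d d ℂ)) (t : ℝ) (ρ : Matrix d d ℂ) : Matrix d d ℂ :=
  ∑' k : ℕ, ((t ^ k / (k.factorial : ℝ) : ℝ) : ℂ) • (𝓛 ^ k) ρ

/-- The operator `L ⊗ I` on the system with a noiseless ancilla with index type `α`. -/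
def withAncilla (α : Type*) [DecidableEq α] (L : Matrix d d ℂ) : Matrix (d × α) (d × α) ℂ :=
  L ⊗ₖ (1 : Matrix α α ℂ)

/-- The evolution for time `t` of the system and a noiseless ancilla, when the jump operators act
on the system only. -/
def extendedEvolution (α : Type*) [Fintype α] [DecidableEq α] {ι κ : Type*} [Fintype ι] [Fintype κ]
    (Ls : ι → Matrix d d ℂ) (Ln : κ → Matrix d d ℂ) (γ : κ → ℝ) (θ t : ℝ)
    (ρ : Matrix (d × α) (d × α) ℂ) : Matrix (d × α) (d × α) ℂ :=
  evolve (generator (fun j => withAncilla α (Ls j)) (fun k => withAncilla α (Ln k)) γ θ) t ρ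

end Lindblad

/-! ### States, measurements, channels and Fisher information -/

section Quantum

variable {e : Type*} [Fintype e] [DecidableEq e]

/-- Density matrices. -/
def IsDensityMatrix (ρ : Matrix e e ℂ) : Prop :=
  ρ.PosSemidef ∧ ρ.trace = 1

/-- Positive operator-valued measures with finitely many outcomes. -/
def IsPOVM {X : Type*} [Fintype X] (E : X → Matrix e e ℂ) : Prop :=
  (∀ x, (E x).PosSemidef) ∧ ∑ x, E x = 1

/-- Quantum channels, through a Kraus representation. -/
def IsChannel (C : Matrix e e ℂ → Matrix e e ℂ) : Prop :=
  ∃ (r : ℕ) (A : Fin r → Matrix e e ℂ), ∑ j, (A j)ᴴ * A j = 1 ∧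
    ∀ ρ, C ρ = ∑ j, A j * ρ * (A j)ᴴ

/-- The probability of the outcome with effect `E` in the state `ρ`. -/
def outcomeProb (ρ E : Matrix e e ℂ) : ℝ :=
  (ρ * E).trace.re

/-- The rank-one operator `|ψ⟩⟨ψ|`. -/
def pureState (ψ : EuclideanSpace ℂ e) : Matrix e e ℂ :=
  Matrix.of fun x y => ψ x * star (ψ y)

/-- The vector `A|ψ⟩`. -/
def applyOp (A : Matrix e e ℂ) (ψ : EuclideanSpace ℂ e) : EuclideanSpace ℂ e :=
  Matrix.toEuclideanLin A ψ

/-- The variance `⟨ψ|A†A|ψ⟩ - |⟨ψ|A|ψ⟩|²`. -/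
def variance (ψ : EuclideanSpace ℂ e) (A : Matrix e e ℂ) : ℝ :=
  ‖applyOp A ψ‖ ^ 2 - ‖⟪ψ, applyOp A ψ⟫_ℂ‖ ^ 2

/-- The classical Fisher information at `θ` of a parametrised probability vector `p`. Outcomes of
probability zero do not contribute (division by zero gives zero). -/
def fisherInfo {X : Type*} [Fintype X] (p : ℝ → X → ℝ) (θ : ℝ) : ℝ :=
  ∑ x, (deriv (fun s => p s x) θ) ^ 2 / p θ x

/-- The law of `M` independent repetitions of an experiment with law `p`. -/
def iidLaw {X : Type*} (p : X → ℝ) (M : ℕ) : (Fin M → X) → ℝ :=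
  fun x => ∏ i, p (x i)

/-- The projection onto the noisy subspace, spanned by `ψ` and the images of `ψ` under the noise
operators. -/
def noisyProjection {κ : Type*} (Ln : κ → Matrix e e ℂ) (ψ : EuclideanSpace ℂ e) :
    Matrix e e ℂ :=
  (Matrix.toEuclideanCLM (n := e) (𝕜 := ℂ)).symm
    (Submodule.span ℂ (insert ψ (Set.range fun k => applyOp (Ln k) ψ))).starProjection

/-- The two-outcome measurement that asks whether the state lies in the noisy subspace. -/
def noisyMeasurement {κ : Type*} (Ln : κ → Matrix e e ℂ) (ψ : EuclideanSpace ℂ e) :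
    Bool → Matrix e e ℂ
  | true => noisyProjection Ln ψ
  | false => 1 - noisyProjection Ln ψ

/-- The state after `M` rounds, each made of one use of `Φ` and then a control operation. -/
def sequentialState (Φ : Matrix e e ℂ → Matrix e e ℂ) (C : ℕ → Matrix e e ℂ → Matrix e e ℂ)
    (ρ : Matrix e e ℂ) : ℕ → Matrix e e ℂ
  | 0 => ρ
  | M + 1 => C M (Φ (sequentialState Φ C ρ M))

end Quantum

/-! ### Metrological strategies of total time `T` -/

section Strategies

variable {d : Type*} [Fintype d] [DecidableEq d] {ι κ : Type*} [Fintype ι] [Fintype κ]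

/-- The Fisher information about `θ` of the extended measure-and-reset strategy which in each of
`M` rounds prepares `ψ`, lets it evolve for time `T / M`, and measures `E`. -/
def measureResetFisherInfo {α : Type*} [Fintype α] [DecidableEq α] (Ls : ι → Matrix d d ℂ)
    (Ln : κ → Matrix d d ℂ) (γ : κ → ℝ) (T : ℝ) (ψ : EuclideanSpace ℂ (d × α))
    {X : Type*} [Fintype X] (E : X → Matrix (d × α) (d × α) ℂ) (θ : ℝ) (M : ℕ) : ℝ≥0∞ :=
  ENNReal.ofReal (fisherInfo (fun s => iidLaw (fun x =>
    outcomeProb (extendedEvolution α Ls Ln γ s (T / M) (pureState ψ)) (E x)) M) θ)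

/-- The quantum Fisher information of the extended measure-and-reset strategy with state `ψ`: the
best Fisher information over all measurements used in the rounds. -/
def measureResetQFI {α : Type*} [Fintype α] [DecidableEq α] (Ls : ι → Matrix d d ℂ)
    (Ln : κ → Matrix d d ℂ) (γ : κ → ℝ) (T : ℝ) (ψ : EuclideanSpace ℂ (d × α))
    (θ : ℝ) (M : ℕ) : ℝ≥0∞ :=
  ⨆ (m : ℕ) (E : Fin m → Matrix (d × α) (d × α) ℂ) (_ : IsPOVM E),
    measureResetFisherInfo Ls Ln γ T ψ E θ M

/-- The optimal quantum Fisher information about `θ` of the extended sequential strategies with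
`M` control operations: the supremum over all finite-dimensional noiseless ancillae, all initial
states, all control channels applied after each evolution for time `T / M`, and all final
measurements. -/
def sequentialQFI (Ls : ι → Matrix d d ℂ) (Ln : κ → Matrix d d ℂ) (γ : κ → ℝ) (T : ℝ)
    (θ : ℝ) (M : ℕ) : ℝ≥0∞ :=
  ⨆ (α : Type) (_ : Fintype α) (_ : DecidableEq α)
    (ρ : Matrix (d × α) (d × α) ℂ) (_ : IsDensityMatrix ρ)
    (C : ℕ → Matrix (d × α) (d × α) ℂ → Matrix (d × α) (d × α) ℂ) (_ : ∀ i, IsChannel (C i))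
    (m : ℕ) (E : Fin m → Matrix (d × α) (d × α) ℂ) (_ : IsPOVM E),
    ENNReal.ofReal (fisherInfo (fun s x =>
      outcomeProb (sequentialState (extendedEvolution α Ls Ln γ s (T / M)) C ρ M) (E x)) θ)

/-- `F θ M` has the limit `v` when first the round length `T / M` tends to zero, i.e. `M → ∞`
(fast control), and then the signal `θ` tends to zero. -/
def HasFastControlVanishingSignalLimit (F : ℝ → ℕ → ℝ≥0∞) (v : ℝ) : Prop :=
  ∃ g : ℝ → ℝ≥0∞, (∀ᶠ θ in 𝓝[>] 0, Tendsto (F θ) atTop (𝓝 (g θ))) ∧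
    Tendsto g (𝓝[>] 0) (𝓝 (ENNReal.ofReal v))

end Strategies

/-! ### Pauli operators and Bell states -/

/-- The one-qubit operators `I, σx, σy, σz`. -/
def pauli : Fin 4 → Matrix (Fin 2) (Fin 2) ℂ :=
  ![1, !![0, 1; 1, 0], !![0, -Complex.I; Complex.I, 0], !![1, 0; 0, -1]]

/-- The tensor product of the `n` one-qubit Pauli operators listed by `P`, in the computational
basis `Fin n → Fin 2`. The zero label is the identity operator. -/
def pauliString {n : ℕ} (P : Fin n → Fin 4) : Matrix (Fin n → Fin 2) (Fin n → Fin 2) ℂ :=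
  Matrix.of fun x y => ∏ i, pauli (P i) (x i) (y i)

/-- The Bell state `d^(-1/2) ∑ j, |e_j⟩ ⊗ |e_j⟩` of an orthonormal basis `b`. -/
def bellState {d : Type*} [Fintype d] (b : OrthonormalBasis d ℂ (EuclideanSpace ℂ d)) :
    EuclideanSpace ℂ (d × d) :=
  WithLp.toLp 2 fun x => (1 / (Real.sqrt (Fintype.card d) : ℂ)) * ∑ j, b j x.1 * b j x.2

end

/-! Pauli operators are Hermitian unitaries that commute up to a sign. Hence every dissipator is
`jump L - 1`, where the jumps are commuting involutions, and the evolution factorises over the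
operators: in time `t` a signal operator acts as "apply `L` with probability `flipProb (θ ^ 2) t`"
(`evolve_smul_involution`).

Upper bound: an `M`-step strategy consumes `M * K` independent coins with round length `t = T / M`,
and `θ` enters only through their bias; noise, controls and measurement are postprocessing that does
not depend on `θ` (`isFlipMixture_sequentialState`). Data processing and additivity bound the Fisher
information by that of the coins. One coin carries at most `4 * t` (`fisherInfo_flip_le`), so the
total is at most `4 * K * T` for all `M ≠ 0` and `θ ≠ 0`, with or without noise.

Lower bound: the Pauli images of a Bell state are orthonormal, since their inner products are
normalised Hilbert–Schmidt products (`inner_applyOp_bellState`). To first order in `t` the noise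
stays inside the noisy subspace and every signal jump leaves it. The outcome "outside" has
probability `θ² K t + o(t)` and `θ`-derivative `2 θ K t + o(t)`, so `M = T / t` rounds yield `4 * K
* T` in the limit (`tendsto_fisher_term`). A sequential strategy reaches the same value by keeping
the outcomes in a noiseless classical record (`measureResetFisherInfo_le_sequentialQFI`). -/

/-! ### Classical Fisher information -/

section FisherInformation

variable {X Y : Type*} [Fintype X] [Fintype Y]

/-- A parametrised probability vector which is differentiable at `θ`. -/
structure IsSmoothLaw (p : ℝ → X → ℝ) (θ : ℝ) : Prop where
  nonneg : ∀ s x, 0 ≤ p s x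
  sum_eq_one : ∀ s, ∑ x, p s x = 1
  differentiableAt : ∀ x, DifferentiableAt ℝ (fun s => p s x) θ

namespace IsSmoothLaw

variable {p : ℝ → X → ℝ} {q : ℝ → Y → ℝ} {θ : ℝ}

/-- A zero of a nonnegative function is a minimum. This makes the convention `x / 0 = 0` harmless
wherever a Fisher term is divided by a vanishing probability. -/
theorem deriv_eq_zero (hp : IsSmoothLaw p θ) {x : X} (hx : p θ x = 0) :
    deriv (fun s => p s x) θ = 0 := by
  apply IsLocalMin.deriv_eq_zero
  exact Eventually.of_forall fun s => by simpa [hx] using hp.nonneg s x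

theorem sum_deriv (hp : IsSmoothLaw p θ) : ∑ x, deriv (fun s => p s x) θ = 0 := by
  rw [← deriv_fun_sum fun x _ => hp.differentiableAt x]
  simp [hp.sum_eq_one]

theorem prod (hp : IsSmoothLaw p θ) (hq : IsSmoothLaw q θ) :
    IsSmoothLaw (fun s (z : X × Y) => p s z.1 * q s z.2) θ where
  nonneg s z := mul_nonneg (hp.nonneg s _) (hq.nonneg s _)
  sum_eq_one s := by
    rw [Fintype.sum_prod_type]
    simp [← Finset.mul_sum, hp.sum_eq_one, hq.sum_eq_one]
  differentiableAt z := (hp.differentiableAt z.1).mul (hq.differentiableAt z.2)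

theorem comp_equiv (hp : IsSmoothLaw p θ) (e : Y ≃ X) :
    IsSmoothLaw (fun s y => p s (e y)) θ where
  nonneg s y := hp.nonneg s _
  sum_eq_one s := by rw [e.sum_comp (fun x => p s x), hp.sum_eq_one]
  differentiableAt y := hp.differentiableAt _

end IsSmoothLaw

variable {p : ℝ → X → ℝ} {q : ℝ → Y → ℝ} {θ : ℝ}

theorem fisherInfo_comp_equiv (p : ℝ → X → ℝ) (e : Y ≃ X) (θ : ℝ) :
    fisherInfo (fun s y => p s (e y)) θ = fisherInfo p θ :=
  e.sum_comp fun x => (deriv (fun s => p s x) θ) ^ 2 / p θ x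

/-- The Fisher information of independent experiments is additive. -/
theorem fisherInfo_prod (hp : IsSmoothLaw p θ) (hq : IsSmoothLaw q θ) :
    fisherInfo (fun s (z : X × Y) => p s z.1 * q s z.2) θ = fisherInfo p θ + fisherInfo q θ := by
  -- The squared product rule divided by `p * q` leaves one Fisher term per factor and a cross term;
  -- the cross term sums to zero because the derivatives of each law do.
  have key : ∀ x y, (deriv (fun s => p s x * q s y) θ) ^ 2 / (p θ x * q θ y) =
      (deriv (fun s => p s x) θ) ^ 2 / p θ x * q θ y
      + 2 * (deriv (fun s => p s x) θ * deriv (fun s => q s y) θ)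
      + p θ x * ((deriv (fun s => q s y) θ) ^ 2 / q θ y) := by
    intro x y
    rw [deriv_fun_mul (hp.differentiableAt x) (hq.differentiableAt y)]
    by_cases hx : p θ x = 0
    · simp [hx, hp.deriv_eq_zero hx]
    by_cases hy : q θ y = 0
    · simp [hy, hq.deriv_eq_zero hy]
    field_simp
    ring
  unfold fisherInfo
  rw [Fintype.sum_prod_type]
  simp only [key, Finset.sum_add_distrib, ← Finset.mul_sum, ← Finset.sum_mul, hp.sum_eq_one,
    hq.sum_eq_one, hp.sum_deriv, hq.sum_deriv]
  ring

theorem iidLaw_cons {Z : Type*} (p : Z → ℝ) (M : ℕ) (z : Z × (Fin M → Z)) :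
    iidLaw p (M + 1) (Fin.consEquiv (fun _ => Z) z) = p z.1 * iidLaw p M z.2 := by
  simp [iidLaw, Fin.prod_univ_succ]

/-- Both claims go through one induction, since additivity in the step needs smoothness of the
`M`-fold law. -/
theorem isSmoothLaw_iid_and_fisherInfo (hp : IsSmoothLaw p θ) (M : ℕ) :
    IsSmoothLaw (fun s => iidLaw (p s) M) θ ∧
      fisherInfo (fun s => iidLaw (p s) M) θ = M * fisherInfo p θ := by
  induction M with
  | zero =>
    refine ⟨⟨fun s x => by simp [iidLaw], fun s => by simp [iidLaw], fun x => ?_⟩, ?_⟩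
    · simp [iidLaw]
    · simp [iidLaw, fisherInfo]
  | succ M ih =>
    have h := (hp.prod ih.1).comp_equiv (Fin.consEquiv (fun _ => X)).symm
    have h2 := fisherInfo_comp_equiv (fun s (z : X × (Fin M → X)) => p s z.1 * iidLaw (p s) M z.2)
      (Fin.consEquiv (fun _ => X)).symm θ
    simp only [← iidLaw_cons, Equiv.apply_symm_apply] at h h2
    refine ⟨h, h2.trans ?_⟩
    simp only [iidLaw_cons]
    rw [fisherInfo_prod hp ih.1, ih.2]
    push_cast
    ring

/-- Postprocessing by a stochastic matrix gives a smooth law. -/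
theorem IsSmoothLaw.postprocess (hq : IsSmoothLaw q θ) {b : Y → X → ℝ} (hb : ∀ y x, 0 ≤ b y x)
    (hb1 : ∀ y, ∑ x, b y x = 1) : IsSmoothLaw (fun s x => ∑ y, q s y * b y x) θ where
  nonneg s x := Finset.sum_nonneg fun y _ => mul_nonneg (hq.nonneg s y) (hb y x)
  sum_eq_one s := by
    rw [Finset.sum_comm]
    simp [← Finset.mul_sum, hb1, hq.sum_eq_one]
  differentiableAt x := DifferentiableAt.fun_sum fun y _ => (hq.differentiableAt y).mul_const _

/-- The data-processing inequality for the Fisher information. -/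
theorem fisherInfo_postprocess_le (hq : IsSmoothLaw q θ) {b : Y → X → ℝ} (hb : ∀ y x, 0 ≤ b y x)
    (hb1 : ∀ y, ∑ x, b y x = 1) :
    fisherInfo (fun s x => ∑ y, q s y * b y x) θ ≤ fisherInfo q θ := by
  have key : ∀ x, (deriv (fun s => ∑ y, q s y * b y x) θ) ^ 2 / ∑ y, q θ y * b y x ≤
      ∑ y, (deriv (fun s => q s y) θ) ^ 2 / q θ y * b y x := by
    intro x
    rw [deriv_fun_sum fun y _ => (hq.differentiableAt y).mul_const _]
    simp only [deriv_mul_const (hq.differentiableAt _)]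
    have h1 : ∀ y, 0 ≤ (deriv (fun s => q s y) θ) ^ 2 / q θ y * b y x := fun y =>
      mul_nonneg (div_nonneg (sq_nonneg _) (hq.nonneg θ y)) (hb y x)
    have h2 : ∀ y, 0 ≤ q θ y * b y x := fun y => mul_nonneg (hq.nonneg θ y) (hb y x)
    refine div_le_of_le_mul₀ (Finset.sum_nonneg fun y _ => h2 y)
      (Finset.sum_nonneg fun y _ => h1 y) ?_
    -- Cauchy–Schwarz, from the termwise identity `(q' b)² = (q'² / q * b) * (q * b)`; where `q`
    -- vanishes, so does `q'`.
    refine Finset.sum_sq_le_sum_mul_sum_of_sq_le_mul _ (fun y _ => h1 y) (fun y _ => h2 y) ?_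
    intro y _
    by_cases hy : q θ y = 0
    · simp [hq.deriv_eq_zero hy]
    · exact le_of_eq (by field_simp)
  refine (Finset.sum_le_sum fun x _ => key x).trans_eq ?_
  rw [Finset.sum_comm]
  simp [← Finset.mul_sum, hb1, fisherInfo]

/-- The law of a coin which shows `true` with probability `q`. -/
def bernoulliLaw (q : ℝ) : Bool → ℝ
  | true => q
  | false => 1 - q

/-- The probability of an odd number of jumps in time `t` at the jump rate `c`. -/
noncomputable def flipProb (c t : ℝ) : ℝ :=
  (1 - Real.exp (-(2 * (t * c)))) / 2

theorem flipProb_nonneg {c t : ℝ} (h : 0 ≤ t * c) : 0 ≤ flipProb c t := by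
  have : Real.exp (-(2 * (t * c))) ≤ 1 := Real.exp_le_one_iff.2 (by linarith)
  unfold flipProb
  linarith

theorem flipProb_le_one (c t : ℝ) : flipProb c t ≤ 1 := by
  have := Real.exp_pos (-(2 * (t * c)))
  unfold flipProb
  linarith

theorem hasDerivAt_flipProb (t θ : ℝ) :
    HasDerivAt (fun s => flipProb (s ^ 2) t) (2 * t * θ * Real.exp (-(2 * (t * θ ^ 2)))) θ := by
  have h : HasDerivAt (fun s : ℝ => -(2 * (t * s ^ 2))) (-(2 * (t * (2 * θ)))) θ := by
    simpa using (((hasDerivAt_pow 2 θ).const_mul t).const_mul 2).fun_neg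
  refine ((h.exp.const_sub 1).div_const 2).congr_deriv ?_
  ring

theorem isSmoothLaw_flip {t : ℝ} (ht : 0 ≤ t) (θ : ℝ) :
    IsSmoothLaw (fun s => bernoulliLaw (flipProb (s ^ 2) t)) θ where
  nonneg s x := by
    cases x
    · exact sub_nonneg.2 (flipProb_le_one _ _)
    · exact flipProb_nonneg (by positivity)
  sum_eq_one s := by simp [bernoulliLaw]
  differentiableAt x := by
    have := (hasDerivAt_flipProb t θ).differentiableAt
    cases x
    · exact this.const_sub 1
    · exact this

/-- With `a = t θ²` and `u = exp (-2a)` the information equals `4t * 4a u² / (1 - u²)`. The last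
factor is at most one because `1 + 4a ≤ exp (4a) = u⁻²`. -/
theorem fisherInfo_flip_le {t : ℝ} (ht : 0 ≤ t) {θ : ℝ} (hθ : θ ≠ 0) :
    fisherInfo (fun s => bernoulliLaw (flipProb (s ^ 2) t)) θ ≤ 4 * t := by
  have h1 := (hasDerivAt_flipProb t θ).deriv
  have h2 := ((hasDerivAt_flipProb t θ).const_sub 1).deriv
  simp only [fisherInfo, Fintype.sum_bool, bernoulliLaw, h1, h2]
  rcases ht.eq_or_lt with rfl | ht
  · simp
  set a := t * θ ^ 2 with ha
  have ha0 : 0 < a := by positivity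
  set u := Real.exp (-(2 * a)) with hu
  have hu0 : 0 < u := Real.exp_pos _
  have hu1 : u < 1 := by rw [hu, Real.exp_lt_one_iff]; linarith
  have hq : flipProb (θ ^ 2) t = (1 - u) / 2 := rfl
  rw [hq]
  have hbound : 4 * a * u ^ 2 ≤ 1 - u ^ 2 := by
    have h4 : 4 * a + 1 ≤ Real.exp (4 * a) := Real.add_one_le_exp _
    have h5 : Real.exp (4 * a) * u ^ 2 = 1 := by
      rw [hu, sq, ← Real.exp_add, ← Real.exp_add]
      ring_nf
      simp
    nlinarith [sq_nonneg u]
  have e : (2 * t * θ * u) ^ 2 / ((1 - u) / 2) + (-(2 * t * θ * u)) ^ 2 / (1 - (1 - u) / 2)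
      = 4 * t * (4 * a * u ^ 2) / (1 - u ^ 2) := by
    have h6 : (1 - u) ≠ 0 := by linarith
    have h7 : (1 + u) ≠ 0 := by linarith
    have h8 : (1 - u ^ 2) ≠ 0 := by
      rw [show 1 - u ^ 2 = (1 - u) * (1 + u) by ring]
      exact mul_ne_zero h6 h7
    have h9 : 1 - (1 - u) / 2 = (1 + u) / 2 := by ring
    rw [h9, ha]
    field_simp
    ring
  rw [e, div_le_iff₀ (by nlinarith)]
  exact mul_le_mul_of_nonneg_left hbound (by positivity)

end FisherInformation

/-! ### The evolution as an operator exponential -/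

section Evolution

variable {d e : Type*} [Fintype d] [Fintype e]

/-- Matrices as vectors of a normed space. -/
noncomputable def vectorize (d : Type*) [Fintype d] :
    Matrix d d ℂ ≃ₗ[ℂ] EuclideanSpace ℂ (d × d) :=
  (Matrix.ofLinearEquiv (m := d) (n := d) (α := ℂ) ℂ).symm ≪≫ₗ
    (LinearEquiv.curry ℂ ℂ d d).symm ≪≫ₗ (WithLp.linearEquiv 2 ℂ (d × d → ℂ)).symm

theorem evolve_zero {d : Type*} (t : ℝ) (ρ : Matrix d d ℂ) : evolve 0 t ρ = ρ := by
  rw [evolve, tsum_eq_single 0 fun k hk => by simp [zero_pow hk]]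
  simp

theorem evolve_time_zero {d : Type*} (A : Module.End ℂ (Matrix d d ℂ)) (ρ : Matrix d d ℂ) :
    evolve A 0 ρ = ρ := by
  rw [evolve, tsum_eq_single 0 fun k hk => by simp [zero_pow hk]]
  simp

/-- Superoperators as continuous linear maps. -/
noncomputable def superCLM (d : Type*) [Fintype d] :
    Module.End ℂ (Matrix d d ℂ) →ₐ[ℂ] (EuclideanSpace ℂ (d × d) →L[ℂ] EuclideanSpace ℂ (d × d)) :=
  (Module.End.toContinuousLinearMap (𝕜 := ℂ) (EuclideanSpace ℂ (d × d))).toAlgHom.comp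
    ((vectorize d).conjAlgEquiv ℂ).toAlgHom

theorem superCLM_apply (A : Module.End ℂ (Matrix d d ℂ)) (ρ : Matrix d d ℂ) :
    superCLM d A (vectorize d ρ) = vectorize d (A ρ) := by
  change vectorize d (A ((vectorize d).symm (vectorize d ρ))) = _
  rw [LinearEquiv.symm_apply_apply]

/-- Convergence matters, since the `tsum` in `evolve` would be zero for a divergent series. It is
inherited from the exponential series of bounded operators through `vectorize`. -/
theorem hasSum_evolve (A : Module.End ℂ (Matrix d d ℂ)) (t : ℝ) (ρ : Matrix d d ℂ) :
    HasSum (fun k : ℕ => ((t ^ k / (k.factorial : ℝ) : ℝ) : ℂ) • (A ^ k) ρ)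
      ((vectorize d).symm (NormedSpace.exp ((t : ℂ) • superCLM d A) (vectorize d ρ))) := by
  have h := NormedSpace.exp_series_hasSum_exp' (𝕂 := ℂ) ((t : ℂ) • superCLM d A)
  have h2 := h.mapL (ContinuousLinearMap.apply ℂ (EuclideanSpace ℂ (d × d)) (vectorize d ρ))
  have hc : Continuous (vectorize d).symm :=
    LinearMap.continuous_of_finiteDimensional (vectorize d).symm.toLinearMap
  refine (h2.map (vectorize d).symm hc).congr_fun ?_
  intro k
  have h3 : ContinuousLinearMap.apply ℂ (EuclideanSpace ℂ (d × d)) (vectorize d ρ)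
      ((k.factorial : ℂ)⁻¹ • ((t : ℂ) • superCLM d A) ^ k) =
      ((t ^ k / (k.factorial : ℝ) : ℝ) : ℂ) • vectorize d ((A ^ k) ρ) := by
    rw [smul_pow, ← map_pow, smul_smul, ContinuousLinearMap.apply_apply, smul_apply,
      superCLM_apply]
    push_cast
    rw [div_eq_inv_mul]
  rw [Function.comp_apply, h3, map_smul, LinearEquiv.symm_apply_apply]

theorem evolve_eq_exp (A : Module.End ℂ (Matrix d d ℂ)) (t : ℝ) (ρ : Matrix d d ℂ) :
    evolve A t ρ =
      (vectorize d).symm (NormedSpace.exp ((t : ℂ) • superCLM d A) (vectorize d ρ)) :=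
  (hasSum_evolve A t ρ).tsum_eq

theorem hasSum_evolve' (A : Module.End ℂ (Matrix d d ℂ)) (t : ℝ) (ρ : Matrix d d ℂ) :
    HasSum (fun k : ℕ => ((t ^ k / (k.factorial : ℝ) : ℝ) : ℂ) • (A ^ k) ρ) (evolve A t ρ) := by
  rw [evolve_eq_exp]
  exact hasSum_evolve A t ρ

/-- Intertwining maps carry evolutions to evolutions. -/
theorem evolve_map {A : Module.End ℂ (Matrix d d ℂ)} {B : Module.End ℂ (Matrix e e ℂ)}
    (f : Matrix d d ℂ →ₗ[ℂ] Matrix e e ℂ) (h : ∀ ρ, B (f ρ) = f (A ρ)) (t : ℝ)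
    (ρ : Matrix d d ℂ) : evolve B t (f ρ) = f (evolve A t ρ) := by
  have hf : Continuous f := LinearMap.continuous_of_finiteDimensional f
  have h1 := (hasSum_evolve' A t ρ).map f hf
  refine (hasSum_evolve' B t (f ρ)).unique (h1.congr_fun ?_)
  intro k
  have h2 : (B ^ k) (f ρ) = f ((A ^ k) ρ) := by
    induction k with
    | zero => rfl
    | succ k ih => rw [pow_succ', pow_succ', Module.End.mul_apply, ih, h, Module.End.mul_apply]
  simp [h2]

theorem evolve_sum {ι : Type*} (s : Finset ι) (A : Module.End ℂ (Matrix d d ℂ)) (t : ℝ)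
    (c : ι → ℂ) (ρ : ι → Matrix d d ℂ) :
    evolve A t (∑ i ∈ s, c i • ρ i) = ∑ i ∈ s, c i • evolve A t (ρ i) := by
  simp only [evolve_eq_exp]
  simp only [map_sum, map_smul]

theorem evolve_add_of_commute {A B : Module.End ℂ (Matrix d d ℂ)} (h : Commute A B) (t : ℝ)
    (ρ : Matrix d d ℂ) : evolve (A + B) t ρ = evolve A t (evolve B t ρ) := by
  have h1 : Commute ((t : ℂ) • superCLM d A) ((t : ℂ) • superCLM d B) :=
    ((h.map (superCLM d)).smul_left _).smul_right _
  let _ : NormedAlgebra ℚ (EuclideanSpace ℂ (d × d) →L[ℂ] EuclideanSpace ℂ (d × d)) :=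
    NormedAlgebra.restrictScalars ℚ ℂ _
  rw [evolve_eq_exp, map_add, smul_add, NormedSpace.exp_add_of_commute h1, evolve_eq_exp A,
    evolve_eq_exp B, LinearEquiv.apply_symm_apply]
  rfl

/-- Exchanging rate for time later turns derivatives in `θ` into derivatives in time. -/
theorem evolve_smul (A : Module.End ℂ (Matrix d d ℂ)) (c t : ℝ) (ρ : Matrix d d ℂ) :
    evolve ((c : ℂ) • A) t ρ = evolve A (t * c) ρ := by
  rw [evolve_eq_exp, evolve_eq_exp, map_smul, smul_smul]
  push_cast
  rfl

/-- The evolution by jumps `J` with `J ^ 2 = 1` only depends on the parity of the number of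
jumps. -/
theorem evolve_smul_involution {J : Module.End ℂ (Matrix d d ℂ)} (hJ : J * J = 1) (c t : ℝ)
    (ρ : Matrix d d ℂ) :
    evolve ((c : ℂ) • (J - 1)) t ρ =
      ((1 - flipProb c t : ℝ) : ℂ) • ρ + ((flipProb c t : ℝ) : ℂ) • J ρ := by
  have hpow : ∀ k : ℕ, (J - 1) ^ (k + 1) = ((-2 : ℂ) ^ k) • (J - 1) := by
    intro k
    induction k with
    | zero => simp
    | succ k ih =>
      rw [pow_succ, ih, smul_mul_assoc, pow_succ, mul_smul]
      congr 1
      have : (J - 1) * (J - 1) = J * J - J - J + 1 := by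
        rw [mul_sub, sub_mul, mul_one, one_mul]; abel
      rw [this, hJ]
      module
  -- Spectral decomposition: `J - 1` has eigenvalue `-2` on the range of `(1 - J) / 2` and `0` on
  -- that of `(1 + J) / 2`, where only the zeroth power survives.
  have hterm : ∀ k : ℕ, (J - 1) ^ k =
      ((-2 : ℂ) ^ k) • ((1 / 2 : ℂ) • (1 - J)) + (if k = 0 then (1 / 2 : ℂ) else 0) • (1 + J) := by
    intro k
    cases k with
    | zero => simp; module
    | succ k => rw [hpow]; simp [pow_succ]; module
  set x : ℝ := -(2 * (t * c)) with hx
  have hexp : HasSum (fun k : ℕ => ((x ^ k / (k.factorial : ℝ) : ℝ) : ℂ)) ((Real.exp x : ℝ) : ℂ) := by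
    rw [Real.exp_eq_exp_ℝ]
    have := NormedSpace.expSeries_div_hasSum_exp (𝔸 := ℝ) x
    exact_mod_cast this
  have h1 := (hexp.smul_const (((1 / 2 : ℂ) • (1 - J)) ρ)).add
    (hasSum_ite_eq 0 ((1 / 2 : ℂ) • ((1 + J) ρ)))
  rw [evolve_smul]
  refine (hasSum_evolve' (J - 1) (t * c) ρ).unique ?_
  convert! h1 using 1
  · funext k
    rw [hterm k]
    rcases eq_or_ne k 0 with rfl | hk
    · simp
    · simp only [hk, if_false, zero_smul, add_zero, LinearMap.smul_apply, smul_smul]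
      congr 1
      rw [hx]
      push_cast
      rw [show (-(2 * ((t : ℂ) * c))) = (t * c) * (-2) by ring, mul_pow]
      ring
  · simp only [flipProb, ← hx, LinearMap.smul_apply, LinearMap.sub_apply, LinearMap.add_apply,
      Module.End.one_apply]
    push_cast
    module

/-- The master equation, tested against a linear functional. -/
theorem hasDerivAt_evolve (A : Module.End ℂ (Matrix d d ℂ)) (ρ : Matrix d d ℂ)
    (φ : Matrix d d ℂ →ₗ[ℂ] ℂ) (t : ℝ) :
    HasDerivAt (fun t : ℝ => (φ (evolve A t ρ)).re) (φ (A (evolve A t ρ))).re t := by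
  have h := hasDerivAt_exp_smul_const' (𝕂 := ℝ) (superCLM d A) t
  let ψ : (EuclideanSpace ℂ (d × d) →L[ℂ] EuclideanSpace ℂ (d × d)) →L[ℝ] ℝ :=
    Complex.reCLM.comp (((LinearMap.toContinuousLinearMap
      (φ ∘ₗ (vectorize d).symm.toLinearMap)).comp (ContinuousLinearMap.apply ℂ
        (EuclideanSpace ℂ (d × d)) (vectorize d ρ))).restrictScalars ℝ)
  have h2 := ψ.hasFDerivAt.comp_hasDerivAt t h
  have h3 : ∀ s : ℝ, ((s : ℂ) • superCLM d A) = s • superCLM d A := fun s => by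
    ext; simp
  simp only [evolve_eq_exp, h3]
  refine h2.congr_deriv ?_
  have h4 : ∀ v, superCLM d A v = vectorize d (A ((vectorize d).symm v)) := fun v => rfl
  simp [ψ, h4]

end Evolution

/-! ### States and measurements -/

section States

variable {e : Type*} [Fintype e]

open scoped MatrixOrder in
theorem Matrix.PosSemidef.exists_eq_conjTranspose_mul_self {A : Matrix e e ℂ}
    (hA : A.PosSemidef) : ∃ B : Matrix e e ℂ, A = Bᴴ * B := by
  classical
  obtain ⟨B, hB⟩ := CStarAlgebra.nonneg_iff_eq_star_mul_self.mp hA.nonneg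
  exact ⟨B, hB⟩

theorem Matrix.PosSemidef.trace_mul_nonneg {A B : Matrix e e ℂ} (hA : A.PosSemidef)
    (hB : B.PosSemidef) : 0 ≤ (A * B).trace := by
  obtain ⟨C, rfl⟩ := hB.exists_eq_conjTranspose_mul_self
  rw [← Matrix.mul_assoc, Matrix.trace_mul_comm, ← Matrix.mul_assoc]
  exact (hA.mul_mul_conjTranspose_same C).trace_nonneg

theorem outcomeProb_nonneg {ρ E : Matrix e e ℂ} (hρ : ρ.PosSemidef) (hE : E.PosSemidef) :
    0 ≤ outcomeProb ρ E :=
  (Complex.nonneg_iff.1 (hρ.trace_mul_nonneg hE)).1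

theorem trace_mul_eq_outcomeProb {ρ E : Matrix e e ℂ} (hρ : ρ.PosSemidef) (hE : E.PosSemidef) :
    (ρ * E).trace = outcomeProb ρ E :=
  Complex.ext rfl (Complex.nonneg_iff.1 (hρ.trace_mul_nonneg hE)).2.symm

theorem sum_outcomeProb [DecidableEq e] {X : Type*} [Fintype X] {ρ : Matrix e e ℂ}
    {E : X → Matrix e e ℂ} (hρ : IsDensityMatrix ρ) (hE : IsPOVM E) :
    ∑ x, outcomeProb ρ (E x) = 1 := by
  simp only [outcomeProb, ← Complex.re_sum, ← Matrix.trace_sum, ← Matrix.mul_sum, hE.2, mul_one,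
    hρ.2, Complex.one_re]

theorem outcomeProb_sum_smul {ι : Type*} (s : Finset ι) (c : ι → ℝ) (ρ : ι → Matrix e e ℂ)
    (E : Matrix e e ℂ) :
    outcomeProb (∑ i ∈ s, (c i : ℂ) • ρ i) E = ∑ i ∈ s, c i * outcomeProb (ρ i) E := by
  simp [outcomeProb, Matrix.sum_mul, Matrix.trace_sum]

/-- Convex combinations of two states. -/
theorem IsDensityMatrix.mix {ρ σ : Matrix e e ℂ} (hρ : IsDensityMatrix ρ) (hσ : IsDensityMatrix σ)
    {q : ℝ} (h0 : 0 ≤ q) (h1 : q ≤ 1) :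
    IsDensityMatrix (((1 - q : ℝ) : ℂ) • ρ + (q : ℂ) • σ) := by
  refine ⟨(hρ.1.smul ?_).add (hσ.1.smul ?_), ?_⟩
  · exact_mod_cast sub_nonneg.2 h1
  · exact_mod_cast h0
  · simp [hρ.2, hσ.2]

theorem IsChannel.isDensityMatrix [DecidableEq e] {C : Matrix e e ℂ → Matrix e e ℂ}
    (hC : IsChannel C) {ρ : Matrix e e ℂ} (hρ : IsDensityMatrix ρ) : IsDensityMatrix (C ρ) := by
  obtain ⟨r, A, hA, h⟩ := hC
  rw [h]
  refine ⟨Matrix.posSemidef_sum _ fun j _ => hρ.1.mul_mul_conjTranspose_same _, ?_⟩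
  rw [Matrix.trace_sum]
  simp only [Matrix.trace_mul_comm (_ * ρ), ← Matrix.mul_assoc]
  rw [← Matrix.trace_sum, ← Matrix.sum_mul, hA, one_mul, hρ.2]

theorem IsChannel.map_sum [DecidableEq e] {C : Matrix e e ℂ → Matrix e e ℂ} (hC : IsChannel C)
    {ι : Type*} (s : Finset ι) (c : ι → ℂ) (ρ : ι → Matrix e e ℂ) :
    C (∑ i ∈ s, c i • ρ i) = ∑ i ∈ s, c i • C (ρ i) := by
  obtain ⟨r, A, -, h⟩ := hC
  simp only [h, Matrix.mul_sum, Matrix.sum_mul, Finset.smul_sum, Matrix.mul_smul, Matrix.smul_mul]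
  rw [Finset.sum_comm]

/-- The operation `ρ ↦ L ρ L†`. -/
def jump (L : Matrix e e ℂ) : Module.End ℂ (Matrix e e ℂ) :=
  LinearMap.mulLeft ℂ L ∘ₗ LinearMap.mulRight ℂ Lᴴ

theorem jump_apply (L ρ : Matrix e e ℂ) : jump L ρ = L * (ρ * Lᴴ) := rfl

theorem IsDensityMatrix.jump [DecidableEq e] {ρ L : Matrix e e ℂ} (hρ : IsDensityMatrix ρ)
    (hL : Lᴴ * L = 1) : IsDensityMatrix (jump L ρ) := by
  rw [jump_apply]
  refine ⟨?_, ?_⟩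
  · rw [← Matrix.mul_assoc]
    exact hρ.1.mul_mul_conjTranspose_same _
  · rw [Matrix.trace_mul_comm, Matrix.mul_assoc, hL, mul_one, hρ.2]

theorem dissipator_eq_jump_sub_one [DecidableEq e] {L : Matrix e e ℂ} (hL : Lᴴ * L = 1) :
    dissipator L = jump L - 1 := by
  rw [dissipator, hL, jump]
  congr 1
  ext1 ρ
  simp
  module

end States

/-! ### Families of involutions that commute up to sign -/

section Involutions

variable {e : Type*} [Fintype e] [DecidableEq e]

/-- Hermitian unitary operators which pairwise commute or anticommute. -/
structure IsPauliFamily {ι : Type*} (L : ι → Matrix e e ℂ) : Prop where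
  conjTranspose_eq : ∀ i, (L i)ᴴ = L i
  mul_self : ∀ i, L i * L i = 1
  comm : ∀ i j, L i * L j = L j * L i ∨ L i * L j = -(L j * L i)

namespace IsPauliFamily

variable {ι κ : Type*} {L : ι → Matrix e e ℂ}

theorem comp (h : IsPauliFamily L) (f : κ → ι) : IsPauliFamily (fun k => L (f k)) where
  conjTranspose_eq _ := h.conjTranspose_eq _
  mul_self _ := h.mul_self _
  comm _ _ := h.comm _ _

theorem withAncilla (h : IsPauliFamily L) (α : Type*) [Fintype α] [DecidableEq α] :
    IsPauliFamily (fun i => withAncilla α (L i)) where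
  conjTranspose_eq i := by
    rw [_root_.withAncilla, Matrix.conjTranspose_kronecker, h.conjTranspose_eq,
      Matrix.conjTranspose_one]
  mul_self i := by
    rw [_root_.withAncilla, ← Matrix.mul_kronecker_mul, h.mul_self, one_mul,
      Matrix.one_kronecker_one]
  comm i j := by
    simp only [_root_.withAncilla, ← Matrix.mul_kronecker_mul]
    refine (h.comm i j).imp (fun h => by rw [h]) (fun h => by rw [h]; ext; simp)

theorem conjTranspose_mul_self (h : IsPauliFamily L) (i : ι) : (L i)ᴴ * L i = 1 := by
  rw [h.conjTranspose_eq, h.mul_self]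

theorem jump_mul_self (h : IsPauliFamily L) (i : ι) : jump (L i) * jump (L i) = 1 := by
  ext1 ρ
  rw [Module.End.mul_apply, jump_apply, jump_apply, h.conjTranspose_eq, ← Matrix.mul_assoc,
    ← Matrix.mul_assoc, h.mul_self, one_mul, Matrix.mul_assoc, h.mul_self, mul_one,
    Module.End.one_apply]

/-- The sign in `L i * L j = ± L j * L i` enters once on each side of `ρ` and cancels. -/
theorem jump_commute (h : IsPauliFamily L) (i j : ι) : Commute (jump (L i)) (jump (L j)) := by
  have key : ∀ (A B ρ : Matrix e e ℂ), A * (B * (ρ * B) * A) = (A * B) * ρ * (B * A) := by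
    intro A B ρ
    simp only [Matrix.mul_assoc]
  ext1 ρ
  simp only [Module.End.mul_apply, jump_apply, h.conjTranspose_eq, key]
  rcases h.comm i j with h | h <;> simp [h]

theorem dissipator_eq (h : IsPauliFamily L) (i : ι) : dissipator (L i) = jump (L i) - 1 :=
  dissipator_eq_jump_sub_one (h.conjTranspose_mul_self i)

theorem dissipator_commute (h : IsPauliFamily L) (i j : ι) :
    Commute (dissipator (L i)) (dissipator (L j)) := by
  rw [h.dissipator_eq, h.dissipator_eq]
  exact ((h.jump_commute i j).sub_left (Commute.one_left _)).sub_right (Commute.one_right _)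

/-- Splits off one jump operator as a coin toss that decides whether `L i` is applied; the
inductions over jump operators rest on it. -/
theorem evolve_insert [DecidableEq ι] (h : IsPauliFamily L) (c : ι → ℝ) {i : ι} {s : Finset ι}
    (hi : i ∉ s) (t : ℝ) (ρ : Matrix e e ℂ) :
    evolve (∑ j ∈ insert i s, (c j : ℂ) • dissipator (L j)) t ρ =
      ((1 - flipProb (c i) t : ℝ) : ℂ) • evolve (∑ j ∈ s, (c j : ℂ) • dissipator (L j)) t ρ
      + ((flipProb (c i) t : ℝ) : ℂ) •
        jump (L i) (evolve (∑ j ∈ s, (c j : ℂ) • dissipator (L j)) t ρ) := by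
  rw [Finset.sum_insert hi, evolve_add_of_commute, h.dissipator_eq i,
    evolve_smul_involution (h.jump_mul_self i)]
  exact Commute.sum_right _ _ _ fun j _ =>
    ((h.dissipator_commute i j).smul_left _).smul_right _

/-- Each jump operator only mixes the state with its conjugate by a unitary, so positivity and trace
survive by induction. -/
theorem isDensityMatrix_evolve (h : IsPauliFamily L) {c : ι → ℝ} (hc : ∀ i, 0 ≤ c i) {t : ℝ}
    (ht : 0 ≤ t) (s : Finset ι) {ρ : Matrix e e ℂ} (hρ : IsDensityMatrix ρ) :
    IsDensityMatrix (evolve (∑ j ∈ s, (c j : ℂ) • dissipator (L j)) t ρ) := by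
  classical
  induction s using Finset.induction_on with
  | empty => simpa [evolve_zero] using hρ
  | insert i s hi ih =>
    rw [h.evolve_insert c hi]
    exact ih.mix (ih.jump (h.conjTranspose_mul_self i)) (flipProb_nonneg (mul_nonneg ht (hc i)))
      (flipProb_le_one _ _)

end IsPauliFamily

end Involutions

/-! ### Simulation by independent coins -/

section FlipMixture

variable {e : Type*} [Fintype e]

/-- The states `F θ` are obtained from `k` independent coins, which show `true` with the
probability `flipProb (θ ^ 2) t`, by preparing a state that depends on the coins but not on `θ`. -/
def IsFlipMixture (t : ℝ) (k : ℕ) (F : ℝ → Matrix e e ℂ) : Prop :=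
  ∃ σ : (Fin k → Bool) → Matrix e e ℂ, (∀ ε, IsDensityMatrix (σ ε)) ∧
    ∀ s, F s = ∑ ε, ((iidLaw (bernoulliLaw (flipProb (s ^ 2) t)) k ε : ℝ) : ℂ) • σ ε

namespace IsFlipMixture

variable {t : ℝ} {k : ℕ} {F : ℝ → Matrix e e ℂ}

theorem const {ρ : Matrix e e ℂ} (hρ : IsDensityMatrix ρ) : IsFlipMixture t 0 fun _ => ρ :=
  ⟨fun _ => ρ, fun _ => hρ, fun s => by simp [iidLaw]⟩

theorem map (hF : IsFlipMixture t k F) {G : Matrix e e ℂ → Matrix e e ℂ}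
    (hG : ∀ ρ, IsDensityMatrix ρ → IsDensityMatrix (G ρ))
    (hlin : ∀ (c : (Fin k → Bool) → ℂ) (ρ : (Fin k → Bool) → Matrix e e ℂ),
      G (∑ i, c i • ρ i) = ∑ i, c i • G (ρ i)) :
    IsFlipMixture t k fun s => G (F s) := by
  obtain ⟨σ, hσ, h⟩ := hF
  exact ⟨fun ε => G (σ ε), fun ε => hG _ (hσ ε), fun s => by
    dsimp only
    rw [h, hlin]⟩

/-- Exhibits the outcome law as the law of the coins sent through the stochastic kernel `outcomeProb
(σ ε) (E x)`, which is free of the parameter. -/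
theorem outcomeProb_eq {X : Type*} {E : X → Matrix e e ℂ} {σ : (Fin k → Bool) → Matrix e e ℂ}
    (h : ∀ s, F s = ∑ ε, ((iidLaw (bernoulliLaw (flipProb (s ^ 2) t)) k ε : ℝ) : ℂ) • σ ε) :
    (fun s x => outcomeProb (F s) (E x)) = fun s x =>
      ∑ ε, iidLaw (bernoulliLaw (flipProb (s ^ 2) t)) k ε * outcomeProb (σ ε) (E x) := by
  funext s x
  rw [h, outcomeProb_sum_smul]

theorem posSemidef (hF : IsFlipMixture t k F) (ht : 0 ≤ t) (s : ℝ) : (F s).PosSemidef := by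
  obtain ⟨σ, hσ, h⟩ := hF
  rw [h]
  refine Matrix.posSemidef_sum _ fun ε _ => (hσ ε).1.smul ?_
  exact_mod_cast (isSmoothLaw_iid_and_fisherInfo (isSmoothLaw_flip ht 0) k).1.nonneg s ε

variable [DecidableEq e]

theorem flip (hF : IsFlipMixture t k F) {L : Matrix e e ℂ} (hL : Lᴴ * L = 1) :
    IsFlipMixture t (k + 1) fun s => ((1 - flipProb (s ^ 2) t : ℝ) : ℂ) • F s
      + ((flipProb (s ^ 2) t : ℝ) : ℂ) • jump L (F s) := by
  obtain ⟨σ, hσ, h⟩ := hF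
  -- The new first coin decides whether `L` is applied to the state prepared from the old coins.
  let τ : Bool × (Fin k → Bool) → Matrix e e ℂ := fun z => bif z.1 then jump L (σ z.2) else σ z.2
  refine ⟨fun ε => τ ((Fin.consEquiv fun _ => Bool).symm ε), fun ε => ?_, fun s => ?_⟩
  · dsimp only
    generalize (Fin.consEquiv fun _ => Bool).symm ε = z
    rcases z with ⟨_ | _, z⟩
    · exact hσ z
    · exact (hσ z).jump hL
  · rw [← (Fin.consEquiv fun _ => Bool).sum_comp, Fintype.sum_prod_type]
    simp only [iidLaw_cons, Equiv.symm_apply_apply, Fintype.sum_bool, τ, bernoulliLaw, cond_true,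
      cond_false, h, map_sum, map_smul, Finset.smul_sum, smul_smul, Complex.ofReal_mul]
    exact add_comm _ _

theorem evolve {ι : Type*} {L : ι → Matrix e e ℂ} (hL : IsPauliFamily L)
    (hF : IsFlipMixture t k F) (s : Finset ι) :
    IsFlipMixture t (k + s.card) fun θ =>
      evolve (∑ j ∈ s, ((θ ^ 2 : ℝ) : ℂ) • dissipator (L j)) t (F θ) := by
  classical
  induction s using Finset.induction_on with
  | empty => simpa [evolve_zero] using hF
  | insert i s hi ih =>
    simp only [hL.evolve_insert (fun _ => _ ^ 2) hi, Finset.card_insert_of_notMem hi]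
    exact ih.flip (hL.conjTranspose_mul_self i)

variable {X : Type*} [Fintype X] {E : X → Matrix e e ℂ} {θ : ℝ}

theorem isSmoothLaw (hF : IsFlipMixture t k F) (hE : IsPOVM E) (ht : 0 ≤ t) (θ : ℝ) :
    IsSmoothLaw (fun s x => outcomeProb (F s) (E x)) θ := by
  obtain ⟨σ, hσ, h⟩ := hF
  rw [outcomeProb_eq h]
  exact (isSmoothLaw_iid_and_fisherInfo (isSmoothLaw_flip ht θ) k).1.postprocess
    (fun ε x => outcomeProb_nonneg (hσ ε).1 (hE.1 x)) (fun ε => sum_outcomeProb (hσ ε) hE)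

/-- Data processing, additivity over the `k` coins, and the bound `4 * t` for one coin. -/
theorem fisherInfo_le (hF : IsFlipMixture t k F) (hE : IsPOVM E) (ht : 0 ≤ t) (hθ : θ ≠ 0) :
    fisherInfo (fun s x => outcomeProb (F s) (E x)) θ ≤ k * (4 * t) := by
  obtain ⟨σ, hσ, h⟩ := hF
  rw [outcomeProb_eq h]
  have hiid := isSmoothLaw_iid_and_fisherInfo (isSmoothLaw_flip ht θ) k
  refine (fisherInfo_postprocess_le hiid.1
    (fun ε x => outcomeProb_nonneg (hσ ε).1 (hE.1 x)) (fun ε => sum_outcomeProb (hσ ε) hE)).trans ?_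
  rw [hiid.2]
  exact mul_le_mul_of_nonneg_left (fisherInfo_flip_le ht hθ) (Nat.cast_nonneg k)

end IsFlipMixture

end FlipMixture

/-! ### Upper bounds on the Fisher information -/

section UpperBounds

variable {d : Type*} [Fintype d] [DecidableEq d] {ι κ : Type*} [Fintype ι] [Fintype κ]
  {Ls : ι → Matrix d d ℂ} {Ln : κ → Matrix d d ℂ} {γ : κ → ℝ}

theorem IsPauliFamily.commute_signal_noise (h : IsPauliFamily (Sum.elim Ls Ln)) (γ : κ → ℝ) :
    Commute (∑ j, dissipator (Ls j)) (∑ k, ((γ k : ℝ) : ℂ) • dissipator (Ln k)) :=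
  Commute.sum_left _ _ _ fun j _ => Commute.sum_right _ _ _ fun k _ =>
    (h.dissipator_commute (Sum.inl j) (Sum.inr k)).smul_right _

theorem IsPauliFamily.evolve_generator (h : IsPauliFamily (Sum.elim Ls Ln)) (γ : κ → ℝ) (θ t : ℝ)
    (ρ : Matrix d d ℂ) :
    evolve (generator Ls Ln γ θ) t ρ = evolve (((θ ^ 2 : ℝ) : ℂ) • ∑ j, dissipator (Ls j)) t
      (evolve (∑ k, ((γ k : ℝ) : ℂ) • dissipator (Ln k)) t ρ) :=
  evolve_add_of_commute ((h.commute_signal_noise γ).smul_left _) t ρ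

/-- The noise commutes with the signal and may act first, as a map of states free of `θ`; the signal
then adds one coin per operator. -/
theorem IsFlipMixture.generator {t : ℝ} {m : ℕ} {F : ℝ → Matrix d d ℂ}
    (h : IsPauliFamily (Sum.elim Ls Ln)) (hγ : ∀ k, 0 ≤ γ k) (ht : 0 ≤ t)
    (hF : IsFlipMixture t m F) :
    IsFlipMixture t (m + Fintype.card ι) fun θ => _root_.evolve (generator Ls Ln γ θ) t (F θ) := by
  simp only [h.evolve_generator, Finset.smul_sum]
  refine (hF.map (fun ρ hρ => ?_) fun c ρ => evolve_sum _ _ _ _ _).evolve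
    (h.comp Sum.inl) Finset.univ
  exact (h.comp Sum.inr).isDensityMatrix_evolve hγ ht _ hρ

variable {α : Type*} [Fintype α] [DecidableEq α]

theorem IsFlipMixture.extendedEvolution {t : ℝ} {m : ℕ} {F : ℝ → Matrix (d × α) (d × α) ℂ}
    (h : IsPauliFamily (Sum.elim Ls Ln)) (hγ : ∀ k, 0 ≤ γ k) (ht : 0 ≤ t)
    (hF : IsFlipMixture t m F) :
    IsFlipMixture t (m + Fintype.card ι) fun θ => extendedEvolution α Ls Ln γ θ t (F θ) := by
  refine hF.generator ?_ hγ ht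
  convert h.withAncilla α using 1
  funext x
  cases x <;> rfl

theorem isFlipMixture_sequentialState {t : ℝ} (h : IsPauliFamily (Sum.elim Ls Ln))
    (hγ : ∀ k, 0 ≤ γ k) (ht : 0 ≤ t) {ρ : Matrix (d × α) (d × α) ℂ} (hρ : IsDensityMatrix ρ)
    {C : ℕ → Matrix (d × α) (d × α) ℂ → Matrix (d × α) (d × α) ℂ} (hC : ∀ i, IsChannel (C i))
    (M : ℕ) :
    IsFlipMixture t (M * Fintype.card ι) fun θ =>
      sequentialState (extendedEvolution α Ls Ln γ θ t) C ρ M := by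
  induction M with
  | zero => rw [zero_mul]; exact IsFlipMixture.const hρ
  | succ M ih =>
    rw [add_mul, one_mul]
    exact (ih.extendedEvolution h hγ ht).map (fun ρ hρ => (hC M).isDensityMatrix hρ)
      fun c ρ => (hC M).map_sum _ _ _

/-- There are `M * card ι` coins worth at most `4 * T / M` each, so the number of rounds cancels and
no limit is needed. -/
theorem sequentialQFI_le (h : IsPauliFamily (Sum.elim Ls Ln)) (hγ : ∀ k, 0 ≤ γ k) {T : ℝ}
    (hT : 0 ≤ T) {θ : ℝ} (hθ : θ ≠ 0) {M : ℕ} (hM : M ≠ 0) :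
    sequentialQFI Ls Ln γ T θ M ≤ ENNReal.ofReal (4 * Fintype.card ι * T) := by
  refine iSup_le fun α => iSup_le fun _ => iSup_le fun _ => iSup_le fun ρ => iSup_le fun hρ =>
    iSup_le fun C => iSup_le fun hC => iSup_le fun m => iSup_le fun E => iSup_le fun hE =>
    ENNReal.ofReal_le_ofReal ?_
  have ht : 0 ≤ T / M := by positivity
  refine ((isFlipMixture_sequentialState h hγ ht hρ hC M).fisherInfo_le hE ht hθ).trans_eq ?_
  push_cast
  field_simp

variable {X : Type*} [Fintype X] {E : X → Matrix (d × α) (d × α) ℂ}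
  {ψ : EuclideanSpace ℂ (d × α)}

theorem measureResetFisherInfo_eq (h : IsPauliFamily (Sum.elim Ls Ln)) (hγ : ∀ k, 0 ≤ γ k) {T : ℝ}
    (hT : 0 ≤ T) (hψ : IsDensityMatrix (pureState ψ)) (hE : IsPOVM E) (θ : ℝ) (M : ℕ) :
    measureResetFisherInfo Ls Ln γ T ψ E θ M = ENNReal.ofReal (M * fisherInfo (fun s x =>
      outcomeProb (extendedEvolution α Ls Ln γ s (T / M) (pureState ψ)) (E x)) θ) := by
  have ht : 0 ≤ T / M := by positivity
  rw [measureResetFisherInfo, (isSmoothLaw_iid_and_fisherInfo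
    (((IsFlipMixture.const hψ).extendedEvolution h hγ ht).isSmoothLaw hE ht θ) M).2]

theorem measureResetFisherInfo_le (h : IsPauliFamily (Sum.elim Ls Ln)) (hγ : ∀ k, 0 ≤ γ k) {T : ℝ}
    (hT : 0 ≤ T) (hψ : IsDensityMatrix (pureState ψ)) (hE : IsPOVM E) {θ : ℝ} (hθ : θ ≠ 0)
    {M : ℕ} (hM : M ≠ 0) :
    measureResetFisherInfo Ls Ln γ T ψ E θ M ≤ ENNReal.ofReal (4 * Fintype.card ι * T) := by
  rw [measureResetFisherInfo_eq h hγ hT hψ hE]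
  have ht : 0 ≤ T / M := by positivity
  have hle := ((IsFlipMixture.const hψ).extendedEvolution h hγ ht).fisherInfo_le hE ht hθ
  refine ENNReal.ofReal_le_ofReal
    ((mul_le_mul_of_nonneg_left hle (Nat.cast_nonneg M)).trans_eq ?_)
  push_cast
  field_simp
  simp

end UpperBounds

/-! ### Short-time asymptotics of the Fisher information of one round -/

section ShortTime

variable {e : Type*} [Fintype e]

/-- The complex outcome probability as a linear functional of the state. -/
def outcomeFunctional (E : Matrix e e ℂ) : Matrix e e ℂ →ₗ[ℂ] ℂ :=
  Matrix.traceLinearMap e ℂ ℂ ∘ₗ LinearMap.mulRight ℂ E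

theorem hasDerivAt_outcomeProb_evolve (A : Module.End ℂ (Matrix e e ℂ)) (ρ E : Matrix e e ℂ)
    (t : ℝ) :
    HasDerivAt (fun t => outcomeProb (evolve A t ρ) E) (outcomeProb (A (evolve A t ρ)) E) t :=
  hasDerivAt_evolve A ρ (outcomeFunctional E) t

theorem outcomeProb_sub (ρ σ E : Matrix e e ℂ) :
    outcomeProb (ρ - σ) E = outcomeProb ρ E - outcomeProb σ E := by
  simp [outcomeProb, Matrix.sub_mul]

theorem outcomeProb_add (ρ σ E : Matrix e e ℂ) :
    outcomeProb (ρ + σ) E = outcomeProb ρ E + outcomeProb σ E := by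
  simp [outcomeProb, Matrix.add_mul]

theorem outcomeProb_smul (c : ℝ) (ρ E : Matrix e e ℂ) :
    outcomeProb ((c : ℂ) • ρ) E = c * outcomeProb ρ E := by
  simp [outcomeProb]

theorem outcomeProb_sum {ι : Type*} (s : Finset ι) (ρ : ι → Matrix e e ℂ) (E : Matrix e e ℂ) :
    outcomeProb (∑ i ∈ s, ρ i) E = ∑ i ∈ s, outcomeProb (ρ i) E := by
  simp [outcomeProb, Matrix.sum_mul, Matrix.trace_sum]

variable [DecidableEq e] {ι κ : Type*} [Fintype ι] [Fintype κ]
  {Ls : ι → Matrix e e ℂ} {Ln : κ → Matrix e e ℂ} {γ : κ → ℝ}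

/-- After the noise is split off, `θ` appears only as the duration `t * θ ^ 2` of the signal
evolution; the chain rule and the master equation give the derivative. -/
theorem hasDerivAt_outcomeProb_generator (h : IsPauliFamily (Sum.elim Ls Ln)) (γ : κ → ℝ) (θ t : ℝ)
    (ρ E : Matrix e e ℂ) :
    HasDerivAt (fun s => outcomeProb (evolve (generator Ls Ln γ s) t ρ) E)
      (2 * t * θ * outcomeProb ((∑ j, dissipator (Ls j)) (evolve (generator Ls Ln γ θ) t ρ)) E)
      θ := by
  simp only [h.evolve_generator, evolve_smul]
  have h1 : HasDerivAt (fun s : ℝ => t * s ^ 2) (t * (2 * θ)) θ := by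
    simpa using (hasDerivAt_pow 2 θ).const_mul t
  have h2 := (hasDerivAt_outcomeProb_evolve (∑ j, dissipator (Ls j))
    (evolve (∑ k, ((γ k : ℝ) : ℂ) • dissipator (Ln k)) t ρ) E (t * θ ^ 2)).comp θ h1
  refine h2.congr_deriv ?_
  ring

variable {ρ E : Matrix e e ℂ}

theorem outcomeProb_signal (h : IsPauliFamily Ls) (h0 : outcomeProb ρ E = 0)
    (hS : ∀ j, outcomeProb (jump (Ls j) ρ) E = 1) :
    outcomeProb ((∑ j, dissipator (Ls j)) ρ) E = Fintype.card ι := by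
  have hj : ∀ j, outcomeProb (dissipator (Ls j) ρ) E = 1 := fun j => by
    rw [h.dissipator_eq j, LinearMap.sub_apply, outcomeProb_sub, Module.End.one_apply, h0, sub_zero]
    exact hS j
  simp [LinearMap.sum_apply, outcomeProb_sum, hj]

/-- The initial growth rate of the outcome `E`: each signal jump contributes one, while the noise
jumps and the identity terms contribute nothing. -/
theorem outcomeProb_generator (h : IsPauliFamily (Sum.elim Ls Ln)) (γ : κ → ℝ)
    (h0 : outcomeProb ρ E = 0) (hS : ∀ j, outcomeProb (jump (Ls j) ρ) E = 1)
    (hN : ∀ k, outcomeProb (jump (Ln k) ρ) E = 0) (θ : ℝ) :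
    outcomeProb (generator Ls Ln γ θ ρ) E = θ ^ 2 * Fintype.card ι := by
  have hk : ∀ k, outcomeProb (dissipator (Ln k) ρ) E = 0 := fun k => by
    have hd : dissipator (Ln k) = jump (Ln k) - 1 := h.dissipator_eq (Sum.inr k)
    rw [hd, LinearMap.sub_apply, outcomeProb_sub, Module.End.one_apply, h0, sub_zero]
    exact hN k
  rw [generator, LinearMap.add_apply, outcomeProb_add, LinearMap.smul_apply, outcomeProb_smul,
    outcomeProb_signal (Ls := Ls) (h.comp Sum.inl) h0 hS]
  simp only [LinearMap.sum_apply, LinearMap.smul_apply, outcomeProb_sum, outcomeProb_smul, hk,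
    mul_zero, Finset.sum_const_zero, add_zero]

theorem tendsto_fisher_term (h : IsPauliFamily (Sum.elim Ls Ln)) (γ : κ → ℝ)
    (h0 : outcomeProb ρ E = 0) (hS : ∀ j, outcomeProb (jump (Ls j) ρ) E = 1)
    (hN : ∀ k, outcomeProb (jump (Ln k) ρ) E = 0) {θ : ℝ} (hθ : θ ≠ 0) {T : ℝ} (hT : 0 < T)
    [Nonempty ι] :
    Tendsto (fun M : ℕ => M * (deriv (fun s =>
        outcomeProb (evolve (generator Ls Ln γ s) (T / M) ρ) E) θ ^ 2 /
        outcomeProb (evolve (generator Ls Ln γ θ) (T / M) ρ) E)) atTop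
      (𝓝 (4 * Fintype.card ι * T)) := by
  set K : ℝ := (Fintype.card ι : ℝ) with hK
  have hK0 : K ≠ 0 := by rw [hK]; exact_mod_cast Fintype.card_ne_zero
  set A := ∑ j, dissipator (Ls j) with hA
  set G := generator Ls Ln γ θ with hG
  -- Here `q t / t → θ² K` and `r t → K` as `t → 0⁺`, while one Fisher term is `(2 t θ r)² / q` and
  -- `M = T / t`.
  let q : ℝ → ℝ := fun t => outcomeProb (evolve G t ρ) E
  let r : ℝ → ℝ := fun t => outcomeProb (A (evolve G t ρ)) E
  have hM : Tendsto (fun M : ℕ => T / (M : ℝ)) atTop (𝓝[>] 0) := by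
    refine tendsto_nhdsWithin_iff.2 ⟨tendsto_const_div_atTop_nhds_zero_nat T, ?_⟩
    filter_upwards [eventually_gt_atTop 0] with M hM
    exact div_pos hT (by exact_mod_cast hM)
  have hq0 : q 0 = 0 := by simp only [q, evolve_time_zero, h0]
  have hq : Tendsto (fun t => q t / t) (𝓝[>] 0) (𝓝 (θ ^ 2 * K)) := by
    have h1 : HasDerivAt q (θ ^ 2 * K) 0 := by
      have := hasDerivAt_outcomeProb_evolve G ρ E 0
      rwa [evolve_time_zero, outcomeProb_generator h γ h0 hS hN θ] at this
    have h2 := h1.tendsto_slope.mono_left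
      (nhdsWithin_mono (0 : ℝ) (fun x (hx : 0 < x) => hx.ne'))
    refine h2.congr fun t => ?_
    rw [slope_def_field, hq0, sub_zero, sub_zero]
  have hr : Tendsto r (𝓝[>] 0) (𝓝 K) := by
    have h1 := (hasDerivAt_evolve G ρ (outcomeFunctional E ∘ₗ A) 0).continuousAt.tendsto
    rw [evolve_time_zero] at h1
    have h2 : ((outcomeFunctional E ∘ₗ A) ρ).re = K := outcomeProb_signal (Ls := Ls) (h.comp Sum.inl) h0 hS
    rw [h2] at h1
    exact h1.mono_left nhdsWithin_le_nhds
  have hlim : Tendsto (fun t => 4 * θ ^ 2 * T * r t ^ 2 / (q t / t)) (𝓝[>] 0)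
      (𝓝 (4 * θ ^ 2 * T * K ^ 2 / (θ ^ 2 * K))) :=
    ((hr.pow 2).const_mul _).div hq (by positivity)
  rw [show 4 * θ ^ 2 * T * K ^ 2 / (θ ^ 2 * K) = 4 * K * T by field_simp] at hlim
  refine (hlim.comp hM).congr' ?_
  filter_upwards [eventually_gt_atTop 0] with M hM
  have hM' : (M : ℝ) ≠ 0 := by exact_mod_cast hM.ne'
  rw [(hasDerivAt_outcomeProb_generator h γ θ (T / M) ρ E).deriv]
  change 4 * θ ^ 2 * T * r (T / M) ^ 2 / (q (T / M) / (T / M)) =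
    M * ((2 * (T / M) * θ * r (T / M)) ^ 2 / q (T / M))
  by_cases hq : q (T / M) = 0
  · simp [hq]
  field_simp
  ring

variable {d : Type*} [Fintype d] [DecidableEq d] {α : Type*} [Fintype α] [DecidableEq α]
  {Ls : ι → Matrix d d ℂ} {Ln : κ → Matrix d d ℂ}

theorem tendsto_measureResetFisherInfo (h : IsPauliFamily (Sum.elim Ls Ln)) (hγ : ∀ k, 0 ≤ γ k)
    {T : ℝ} (hT : 0 < T) {ψ : EuclideanSpace ℂ (d × α)} (hψ : IsDensityMatrix (pureState ψ))
    {E : Bool → Matrix (d × α) (d × α) ℂ} (hE : IsPOVM E)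
    (h0 : outcomeProb (pureState ψ) (E false) = 0)
    (hS : ∀ j, outcomeProb (jump (withAncilla α (Ls j)) (pureState ψ)) (E false) = 1)
    (hN : ∀ k, outcomeProb (jump (withAncilla α (Ln k)) (pureState ψ)) (E false) = 0)
    {θ : ℝ} (hθ : θ ≠ 0) :
    Tendsto (measureResetFisherInfo Ls Ln γ T ψ E θ) atTop
      (𝓝 (ENNReal.ofReal (4 * Fintype.card ι * T))) := by
  have hup : ∀ᶠ M in atTop, measureResetFisherInfo Ls Ln γ T ψ E θ M ≤
      ENNReal.ofReal (4 * Fintype.card ι * T) :=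
    (eventually_ne_atTop 0).mono fun M hM =>
      measureResetFisherInfo_le h hγ hT.le hψ hE hθ hM
  -- Without signal operators the ratio of leading terms would be `0 / 0`, but the upper bound is
  -- already zero.
  rcases isEmpty_or_nonempty ι with hι | hι
  · simp only [Fintype.card_eq_zero, Nat.cast_zero, mul_zero, zero_mul, ENNReal.ofReal_zero,
      nonpos_iff_eq_zero] at hup ⊢
    exact tendsto_const_nhds.congr' (hup.mono fun M hM => hM.symm)
  have hfam : IsPauliFamily (Sum.elim (fun j => withAncilla α (Ls j))
      (fun k => withAncilla α (Ln k))) := by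
    convert h.withAncilla α using 1
    funext x
    cases x <;> rfl
  -- Squeeze: the term of the outcome `false` alone reaches the upper bound in the limit, and the
  -- other term is nonnegative.
  refine tendsto_of_tendsto_of_tendsto_of_le_of_le'
    (ENNReal.tendsto_ofReal (tendsto_fisher_term hfam γ h0 hS hN hθ hT)) tendsto_const_nhds
    (Eventually.of_forall fun M => ?_) hup
  rw [measureResetFisherInfo_eq h hγ hT.le hψ hE]
  refine ENNReal.ofReal_le_ofReal (mul_le_mul_of_nonneg_left ?_ (Nat.cast_nonneg M))
  have hs := ((IsFlipMixture.const hψ).extendedEvolution h hγ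
    (show 0 ≤ T / M by positivity)).isSmoothLaw hE (show 0 ≤ T / M by positivity) θ
  rw [fisherInfo, Fintype.sum_bool]
  exact le_add_of_nonneg_left (div_nonneg (sq_nonneg _) (hs.nonneg θ true))

theorem measureResetFisherInfo_le_measureResetQFI (Ls : ι → Matrix d d ℂ) (Ln : κ → Matrix d d ℂ)
    (γ : κ → ℝ) (T : ℝ) (ψ : EuclideanSpace ℂ (d × α)) {X : Type*} [Fintype X]
    {E : X → Matrix (d × α) (d × α) ℂ} (hE : IsPOVM E) (θ : ℝ) (M : ℕ) :
    measureResetFisherInfo Ls Ln γ T ψ E θ M ≤ measureResetQFI Ls Ln γ T ψ θ M := by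
  let f := (Fintype.equivFin X).symm
  have hE' : IsPOVM fun i => E (f i) := ⟨fun i => hE.1 _, by rw [f.sum_comp E, hE.2]⟩
  refine le_iSup_of_le _ (le_iSup_of_le (fun i => E (f i)) (le_iSup_of_le hE' ?_))
  refine ENNReal.ofReal_le_ofReal (le_of_eq ?_)
  exact (fisherInfo_comp_equiv (fun s => iidLaw (fun x => outcomeProb
    (extendedEvolution α Ls Ln γ s (T / M) (pureState ψ)) (E x)) M)
    (Equiv.arrowCongr (Equiv.refl (Fin M)) f) θ).symm

end ShortTime

/-! ### Sequential strategies simulate measure-and-reset strategies -/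

section Record

variable {d α R : Type*}

/-- The operator `X ⊗ D` on the qubits, the ancilla and a classical record. -/
def attach (D : Matrix R R ℂ) : Matrix (d × α) (d × α) ℂ →ₗ[ℂ]
    Matrix (d × (α × R)) (d × (α × R)) ℂ where
  toFun X := (X ⊗ₖ D).submatrix (Equiv.prodAssoc d α R).symm (Equiv.prodAssoc d α R).symm
  map_add' X Y := by rw [Matrix.add_kronecker]; rfl
  map_smul' c X := by rw [Matrix.smul_kronecker]; rfl

theorem attach_apply (D : Matrix R R ℂ) (X : Matrix (d × α) (d × α) ℂ) :
    attach D X =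
      (X ⊗ₖ D).submatrix (Equiv.prodAssoc d α R).symm (Equiv.prodAssoc d α R).symm := rfl

theorem attach_conjTranspose (D : Matrix R R ℂ) (X : Matrix (d × α) (d × α) ℂ) :
    (attach D X)ᴴ = attach Dᴴ Xᴴ := by
  rw [attach_apply, Matrix.conjTranspose_submatrix, Matrix.conjTranspose_kronecker]
  rfl

theorem attach_zero (X : Matrix (d × α) (d × α) ℂ) : attach (0 : Matrix R R ℂ) X = 0 := by
  rw [attach_apply, Matrix.kronecker_zero]
  rfl

theorem sum_attach {ι : Type*} (s : Finset ι) (D : ι → Matrix R R ℂ)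
    (X : Matrix (d × α) (d × α) ℂ) : ∑ i ∈ s, attach (D i) X = attach (∑ i ∈ s, D i) X := by
  ext
  simp [attach_apply, Matrix.sum_apply, Finset.mul_sum]

theorem attach_one_one [DecidableEq d] [DecidableEq α] [DecidableEq R] :
    attach (1 : Matrix R R ℂ) (1 : Matrix (d × α) (d × α) ℂ) = 1 := by
  rw [attach_apply, Matrix.one_kronecker_one, Matrix.submatrix_one_equiv]

theorem withAncilla_prod [DecidableEq α] [DecidableEq R] (L : Matrix d d ℂ) :
    withAncilla (α × R) L = attach (1 : Matrix R R ℂ) (withAncilla α L) := by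
  rw [withAncilla, withAncilla, ← Matrix.one_kronecker_one, attach_apply,
    ← Matrix.kronecker_assoc]
  rfl

variable [Fintype d] [Fintype α] [Fintype R]

theorem attach_mul (D D' : Matrix R R ℂ) (X X' : Matrix (d × α) (d × α) ℂ) :
    attach D X * attach D' X' = attach (D * D') (X * X') := by
  rw [attach_apply, attach_apply, attach_apply, Matrix.submatrix_mul_equiv,
    Matrix.mul_kronecker_mul]

theorem trace_attach (D : Matrix R R ℂ) (X : Matrix (d × α) (d × α) ℂ) :
    (attach D X).trace = X.trace * D.trace := by
  rw [← Matrix.trace_kronecker, attach_apply]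
  exact (Equiv.prodAssoc d α R).symm.sum_comp fun i => (X ⊗ₖ D) i i

variable [DecidableEq d] [DecidableEq α] [DecidableEq R]

theorem dissipator_attach (L : Matrix d d ℂ) (D : Matrix R R ℂ) (X : Matrix (d × α) (d × α) ℂ) :
    dissipator (withAncilla (α × R) L) (attach D X) =
      attach D (dissipator (withAncilla α L) X) := by
  simp only [dissipator, LinearMap.sub_apply, LinearMap.smul_apply, LinearMap.add_apply,
    LinearMap.comp_apply, LinearMap.mulLeft_apply, LinearMap.mulRight_apply, withAncilla_prod,
    attach_conjTranspose, attach_mul, Matrix.conjTranspose_one, one_mul, mul_one, map_sub, map_smul,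
    map_add]

variable {ι κ : Type*} [Fintype ι] [Fintype κ]

/-- The jump operators act trivially on the record, so `attach D` intertwines the two generators. -/
theorem extendedEvolution_attach (Ls : ι → Matrix d d ℂ) (Ln : κ → Matrix d d ℂ) (γ : κ → ℝ)
    (θ t : ℝ) (D : Matrix R R ℂ) (X : Matrix (d × α) (d × α) ℂ) :
    extendedEvolution (α × R) Ls Ln γ θ t (attach D X) =
      attach D (extendedEvolution α Ls Ln γ θ t X) := by
  refine evolve_map (attach D) (fun ρ => ?_) t X
  simp only [generator, LinearMap.add_apply, LinearMap.smul_apply, LinearMap.sum_apply,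
    dissipator_attach, map_add, map_smul, map_sum]

end Record

/-! ### Measurement and reset as control channels that write a classical record -/

section Simulation

variable {e : Type*} [Fintype e]

theorem IsChannel.of_kraus [DecidableEq e] {J : Type*} [Fintype J] (A : J → Matrix e e ℂ)
    (hA : ∑ j, (A j)ᴴ * A j = 1) : IsChannel fun ρ => ∑ j, A j * ρ * (A j)ᴴ := by
  let f := (Fintype.equivFin J).symm
  refine ⟨Fintype.card J, fun i => A (f i), ?_, fun ρ => ?_⟩
  · rw [f.sum_comp fun j => (A j)ᴴ * A j, hA]
  · rw [f.sum_comp fun j => A j * ρ * (A j)ᴴ]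

/-- A Kraus operator of the measurement of `Bᴴ * B`, followed by the preparation of `ψ`. -/
def resetKraus (ψ : EuclideanSpace ℂ e) (B : Matrix e e ℂ) (i : e) : Matrix e e ℂ :=
  Matrix.vecMulVec ψ (B i)

theorem sum_resetKraus {ψ : EuclideanSpace ℂ e} (hψ : (pureState ψ).trace = 1)
    (B : Matrix e e ℂ) : ∑ i, (resetKraus ψ B i)ᴴ * resetKraus ψ B i = Bᴴ * B := by
  have h1 : ∑ x, star (ψ x) * ψ x = 1 := by
    rw [← hψ]
    exact Finset.sum_congr rfl fun x _ => mul_comm _ _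
  ext a b
  simp only [Matrix.sum_apply, Matrix.mul_apply, resetKraus, Matrix.conjTranspose_apply,
    Matrix.vecMulVec_apply, star_mul']
  refine Finset.sum_congr rfl fun i _ => ?_
  calc ∑ x, star (ψ x) * star (B i a) * (ψ x * B i b)
      = (∑ x, star (ψ x) * ψ x) * (star (B i a) * B i b) := by
        rw [Finset.sum_mul]
        exact Finset.sum_congr rfl fun x _ => by ring
    _ = _ := by rw [h1, one_mul]

/-- Each Kraus operator is `|ψ⟩` times a row of `B`. Summing over the rows forgets the state and
keeps only the probability of the effect `Bᴴ * B`. -/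
theorem sum_resetKraus_apply (ψ : EuclideanSpace ℂ e) (B ρ : Matrix e e ℂ) :
    ∑ i, resetKraus ψ B i * ρ * (resetKraus ψ B i)ᴴ = (ρ * (Bᴴ * B)).trace • pureState ψ := by
  have h1 : (ρ * (Bᴴ * B)).trace = ∑ i, ∑ y, ∑ x, B i x * ρ x y * star (B i y) := by
    rw [← Matrix.mul_assoc, Matrix.trace_mul_comm, ← Matrix.mul_assoc]
    simp only [Matrix.trace, Matrix.diag_apply, Matrix.mul_apply, Finset.sum_mul,
      Matrix.conjTranspose_apply]
  ext a b
  rw [h1]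
  simp only [Matrix.sum_apply, Matrix.mul_apply, resetKraus, Matrix.conjTranspose_apply,
    Matrix.vecMulVec_apply, star_mul', Matrix.smul_apply, pureState, Matrix.of_apply, smul_eq_mul,
    Finset.sum_mul]
  refine Finset.sum_congr rfl fun i _ => Finset.sum_congr rfl fun y _ =>
    Finset.sum_congr rfl fun x _ => ?_
  ring

/-- The record `r` with the entry number `k` replaced by `x`. -/
def writeRecord {X : Type*} {M : ℕ} (k : ℕ) (x : X) (r : Fin M → X) : Fin M → X :=
  fun i => if i.val = k then x else r i

/-- The record after the outcomes `h` of the first `k` rounds. -/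
def recordOf {X : Type*} {M k : ℕ} (x₀ : X) (h : Fin k → X) : Fin M → X :=
  fun i => if hi : i.val < k then h ⟨i.val, hi⟩ else x₀

/-- Unwritten entries hold the default `x₀`, so writing entry `k` amounts to appending an outcome to
the history. -/
theorem writeRecord_recordOf {X : Type*} {M k : ℕ} (x₀ x : X) (h : Fin k → X) :
    writeRecord k x (recordOf (M := M) x₀ h) = recordOf x₀ (Fin.snoc (α := fun _ => X) h x) := by
  funext i
  simp only [writeRecord, recordOf, Fin.snoc]
  rcases lt_trichotomy i.val k with hi | hi | hi
  · simp [hi, hi.ne, hi.trans k.lt_succ_self]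
  · simp [hi]
  · rw [if_neg hi.ne', dif_neg (by omega), dif_neg (by omega)]

theorem recordOf_self {X : Type*} {M : ℕ} (x₀ : X) (h : Fin M → X) : recordOf x₀ h = h := by
  funext i
  simp [recordOf]

variable {d : Type*} [Fintype d] {α X : Type*} [Fintype α] [Fintype X] [DecidableEq X]

/-- A Kraus operator of the control operation which measures, writes the outcome `x` to the
entry number `k` of the record, and resets. -/
def controlKraus {M : ℕ} (ψ : EuclideanSpace ℂ (d × α)) (B : X → Matrix (d × α) (d × α) ℂ) (k : ℕ)
    (j : (Fin M → X) × X × (d × α)) :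
    Matrix (d × (α × (Fin M → X))) (d × (α × (Fin M → X))) ℂ :=
  attach (Matrix.single (writeRecord k j.2.1 j.1) j.1 1) (resetKraus ψ (B j.2.1) j.2.2)

/-- Only the Kraus operators that read the actual record value `r` contribute; those for other
values annihilate the state. -/
theorem controlKraus_apply {M : ℕ} (ψ : EuclideanSpace ℂ (d × α))
    (B : X → Matrix (d × α) (d × α) ℂ) (k : ℕ) (r : Fin M → X) (ρ : Matrix (d × α) (d × α) ℂ) :
    ∑ j, controlKraus ψ B k j * attach (Matrix.single r r 1) ρ * (controlKraus ψ B k j)ᴴ =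
      ∑ x, (ρ * ((B x)ᴴ * B x)).trace •
        attach (Matrix.single (writeRecord k x r) (writeRecord k x r) 1) (pureState ψ) := by
  rw [Fintype.sum_prod_type, Finset.sum_eq_single r]
  · rw [Fintype.sum_prod_type]
    refine Finset.sum_congr rfl fun x _ => ?_
    simp only [controlKraus, attach_conjTranspose, attach_mul, Matrix.conjTranspose_single,
      Matrix.single_mul_single_same, star_one, mul_one, ← map_sum, sum_resetKraus_apply, map_smul]
  · intro r' _ hr
    refine Finset.sum_eq_zero fun z _ => ?_
    simp only [controlKraus, attach_mul]
    rw [Matrix.single_mul_single_of_ne _ _ _ _ hr, attach_zero, Matrix.zero_mul]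
  · simp

/-- After each control the qubits and old ancilla are back in `ψ`, and the record is a classical
mixture of histories weighted by the product law. The hypothesis `hΦ` combines linearity with
trivial action on the record. -/
theorem sequentialState_control {M : ℕ} {ψ : EuclideanSpace ℂ (d × α)}
    (B : X → Matrix (d × α) (d × α) ℂ) (x₀ : X)
    {Φ : Matrix (d × α) (d × α) ℂ → Matrix (d × α) (d × α) ℂ}
    {Φ' : Matrix (d × (α × (Fin M → X))) (d × (α × (Fin M → X))) ℂ →
      Matrix (d × (α × (Fin M → X))) (d × (α × (Fin M → X))) ℂ}
    (hΦ : ∀ {m : ℕ} (c : (Fin m → X) → ℂ) (D : (Fin m → X) → Matrix (Fin M → X) (Fin M → X) ℂ) ρ,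
      Φ' (∑ i, c i • attach (D i) ρ) = ∑ i, c i • attach (D i) (Φ ρ))
    {p : X → ℝ} (hp : ∀ x, (Φ (pureState ψ) * ((B x)ᴴ * B x)).trace = p x) (k : ℕ) :
    sequentialState Φ' (fun k ρ => ∑ j, controlKraus ψ B k j * ρ * (controlKraus ψ B k j)ᴴ)
      (attach (Matrix.single (fun _ => x₀) (fun _ => x₀) 1) (pureState ψ)) k =
      ∑ h : Fin k → X, ((iidLaw p k h : ℝ) : ℂ) •
        attach (Matrix.single (recordOf x₀ h) (recordOf x₀ h) 1) (pureState ψ) := by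
  induction k with
  | zero =>
    simp only [sequentialState, Fintype.sum_unique, iidLaw, Finset.univ_eq_empty,
      Finset.prod_empty, Complex.ofReal_one, one_smul]
    rfl
  | succ k ih =>
    rw [sequentialState, ih, hΦ]
    simp only [Matrix.mul_sum, Matrix.sum_mul, Matrix.mul_smul, Matrix.smul_mul]
    rw [Finset.sum_comm]
    simp only [← Finset.smul_sum, controlKraus_apply, hp, writeRecord_recordOf]
    -- A history of `k + 1` rounds is split into its first `k` outcomes and the last one.
    rw [← (Fin.snocEquiv fun _ => X).sum_comp, Fintype.sum_prod_type, Finset.sum_comm]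
    refine Finset.sum_congr rfl fun h _ => ?_
    rw [Finset.smul_sum]
    refine Finset.sum_congr rfl fun x _ => ?_
    rw [smul_smul, ← Complex.ofReal_mul]
    simp [iidLaw, Fin.snocEquiv, Fin.prod_univ_castSucc]

variable [DecidableEq d] [DecidableEq α]

theorem sum_controlKraus {M : ℕ} {ψ : EuclideanSpace ℂ (d × α)} (hψ : (pureState ψ).trace = 1)
    {B : X → Matrix (d × α) (d × α) ℂ} (hB : ∑ x, (B x)ᴴ * B x = 1) (k : ℕ) :
    ∑ j, (controlKraus (M := M) ψ B k j)ᴴ * controlKraus ψ B k j = 1 := by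
  simp only [Fintype.sum_prod_type (α₁ := Fin M → X), Fintype.sum_prod_type (α₁ := X),
    controlKraus, attach_conjTranspose, attach_mul, Matrix.conjTranspose_single,
    Matrix.single_mul_single_same, star_one, mul_one, ← map_sum, sum_resetKraus hψ, hB,
    sum_attach]
  rw [Matrix.sum_single_one, attach_one_one]

theorem isPOVM_record (M : ℕ) : IsPOVM fun r : Fin M → X =>
    attach (d := d) (α := α) (Matrix.single r r (1 : ℂ)) 1 := by
  refine ⟨fun r => ?_, ?_⟩
  · have : attach (d := d) (α := α) (Matrix.single r r (1 : ℂ)) 1 =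
        (attach (Matrix.single r r (1 : ℂ)) 1)ᴴ * attach (Matrix.single r r (1 : ℂ)) 1 := by
      simp [attach_conjTranspose, attach_mul]
    dsimp only
    rw [this]
    exact Matrix.posSemidef_conjTranspose_mul_self _
  · rw [sum_attach, Matrix.sum_single_one, attach_one_one]

theorem outcomeProb_record {M : ℕ} {ψ : EuclideanSpace ℂ (d × α)} (hψ : (pureState ψ).trace = 1)
    (w : (Fin M → X) → ℝ) (r : Fin M → X) :
    outcomeProb (∑ h, ((w h : ℝ) : ℂ) • attach (Matrix.single h h 1) (pureState ψ))
      (attach (Matrix.single r r 1) 1) = w r := by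
  rw [outcomeProb_sum_smul, Finset.sum_eq_single r]
  · simp [outcomeProb, attach_mul, trace_attach, hψ]
  · intro h _ hr
    rw [outcomeProb, attach_mul, Matrix.single_mul_single_of_ne _ _ _ _ hr, attach_zero]
    simp
  · simp

variable {ι κ : Type*} [Fintype ι] [Fintype κ] {Ls : ι → Matrix d d ℂ} {Ln : κ → Matrix d d ℂ}
  {γ : κ → ℝ}

/-- With a noiseless record, a sequential strategy can measure and reset in each step. -/
theorem measureResetFisherInfo_le_sequentialQFI {α X : Type} [Fintype α] [DecidableEq α]
    [Fintype X] [DecidableEq X] [Nonempty X] (h : IsPauliFamily (Sum.elim Ls Ln))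
    (hγ : ∀ k, 0 ≤ γ k) {T : ℝ} (hT : 0 ≤ T) {ψ : EuclideanSpace ℂ (d × α)}
    (hψ : IsDensityMatrix (pureState ψ)) {E : X → Matrix (d × α) (d × α) ℂ} (hE : IsPOVM E)
    (θ : ℝ) (M : ℕ) :
    measureResetFisherInfo Ls Ln γ T ψ E θ M ≤ sequentialQFI Ls Ln γ T θ M := by
  choose B hB using fun x => (hE.1 x).exists_eq_conjTranspose_mul_self
  obtain ⟨x₀⟩ := ‹Nonempty X›
  have hBsum : ∑ x, (B x)ᴴ * B x = 1 := by simp only [← hB, hE.2]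
  let C : ℕ → Matrix (d × (α × (Fin M → X))) (d × (α × (Fin M → X))) ℂ →
      Matrix (d × (α × (Fin M → X))) (d × (α × (Fin M → X))) ℂ :=
    fun k ρ => ∑ j, controlKraus ψ B k j * ρ * (controlKraus ψ B k j)ᴴ
  let ρ₀ : Matrix (d × (α × (Fin M → X))) (d × (α × (Fin M → X))) ℂ :=
    attach (Matrix.single (fun _ => x₀) (fun _ => x₀) 1) (pureState ψ)
  have hC : ∀ i, IsChannel (C i) := fun i => IsChannel.of_kraus _ (sum_controlKraus hψ.2 hBsum i)
  have hρ₀ : IsDensityMatrix ρ₀ := by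
    constructor
    · obtain ⟨A, hA⟩ := hψ.1.exists_eq_conjTranspose_mul_self
      have : ρ₀ = (attach (Matrix.single (fun _ => x₀) (fun _ => x₀) 1) A)ᴴ *
          attach (Matrix.single (fun _ => x₀) (fun _ => x₀) 1) A := by
        simp [ρ₀, attach_conjTranspose, attach_mul, hA]
      rw [this]
      exact Matrix.posSemidef_conjTranspose_mul_self _
    · simp [ρ₀, trace_attach, hψ.2]
  let f := (Fintype.equivFin (Fin M → X)).symm
  let E' : (Fin M → X) → Matrix (d × (α × (Fin M → X))) (d × (α × (Fin M → X))) ℂ :=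
    fun r => attach (Matrix.single r r 1) 1
  have hE' : IsPOVM fun i => E' (f i) :=
    ⟨fun i => (isPOVM_record M).1 _, by rw [f.sum_comp E']; exact (isPOVM_record M).2⟩
  -- The ancilla is the old one together with a register for `M` outcomes; the final measurement
  -- reads that register.
  refine le_iSup_of_le (α × (Fin M → X)) <| le_iSup_of_le inferInstance <|
    le_iSup_of_le inferInstance <| le_iSup_of_le ρ₀ <| le_iSup_of_le hρ₀ <| le_iSup_of_le C <|
    le_iSup_of_le hC <| le_iSup_of_le _ <| le_iSup_of_le (fun i => E' (f i)) <|
    le_iSup_of_le hE' <| ENNReal.ofReal_le_ofReal <| le_of_eq ?_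
  have hlaw : ∀ s r, outcomeProb (sequentialState
      (extendedEvolution (α × (Fin M → X)) Ls Ln γ s (T / M)) C ρ₀ M) (E' r) =
      iidLaw (fun x => outcomeProb (extendedEvolution α Ls Ln γ s (T / M) (pureState ψ)) (E x))
        M r := by
    intro s r
    have ht : 0 ≤ T / M := by positivity
    have hdens := ((IsFlipMixture.const hψ).extendedEvolution h hγ ht).posSemidef ht s
    rw [sequentialState_control B x₀ (Φ := extendedEvolution α Ls Ln γ s (T / M))
      (p := fun x => outcomeProb (extendedEvolution α Ls Ln γ s (T / M) (pureState ψ)) (E x))]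
    · simp only [recordOf_self]
      exact outcomeProb_record hψ.2 _ r
    · intro m c D ρ
      simp only [← extendedEvolution_attach]
      exact evolve_sum _ _ _ _ _
    · intro x
      rw [← hB, trace_mul_eq_outcomeProb hdens (hE.1 x)]
  simp only [hlaw]
  exact (fisherInfo_comp_equiv _ f θ).symm

end Simulation

/-! ### Pauli strings -/

section PauliStrings

/-- The tensor product of one-qubit operators. -/
def qubitTensor {n : ℕ} (A : Fin n → Matrix (Fin 2) (Fin 2) ℂ) :
    Matrix (Fin n → Fin 2) (Fin n → Fin 2) ℂ :=
  Matrix.of fun x y => ∏ i, A i (x i) (y i)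

variable {n : ℕ}

theorem qubitTensor_mul (A B : Fin n → Matrix (Fin 2) (Fin 2) ℂ) :
    qubitTensor A * qubitTensor B = qubitTensor fun i => A i * B i := by
  ext x z
  simp only [qubitTensor, Matrix.mul_apply, Matrix.of_apply, Finset.prod_univ_sum,
    Fintype.piFinset_univ, Finset.prod_mul_distrib]

theorem qubitTensor_one : qubitTensor (fun _ : Fin n => 1) = 1 := by
  ext x y
  simp only [qubitTensor, Matrix.of_apply, Matrix.one_apply, Finset.prod_ite_zero,
    Finset.prod_const_one, Finset.mem_univ, true_imp_iff, funext_iff]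

theorem qubitTensor_conjTranspose (A : Fin n → Matrix (Fin 2) (Fin 2) ℂ) :
    (qubitTensor A)ᴴ = qubitTensor fun i => (A i)ᴴ := by
  ext x y
  simp [qubitTensor]

theorem qubitTensor_smul (c : Fin n → ℂ) (A : Fin n → Matrix (Fin 2) (Fin 2) ℂ) :
    qubitTensor (fun i => c i • A i) = (∏ i, c i) • qubitTensor A := by
  ext x y
  simp [qubitTensor, Finset.prod_mul_distrib]

theorem trace_qubitTensor (A : Fin n → Matrix (Fin 2) (Fin 2) ℂ) :
    (qubitTensor A).trace = ∏ i, (A i).trace := by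
  simp only [Matrix.trace, Matrix.diag_apply, Finset.prod_univ_sum, Fintype.piFinset_univ]
  rfl

theorem pauli_conjTranspose (a : Fin 4) : (pauli a)ᴴ = pauli a := by
  fin_cases a <;> ext i j <;> fin_cases i <;> fin_cases j <;> simp [pauli]

theorem pauli_mul_self (a : Fin 4) : pauli a * pauli a = 1 := by
  fin_cases a <;> ext i j <;> fin_cases i <;> fin_cases j <;> simp [pauli, Matrix.mul_apply]

/-- The sign is kept as a scalar, so that the signs of the qubits multiply to the sign of the whole
tensor product. -/
theorem exists_pauli_mul_comm (a b : Fin 4) :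
    ∃ c : ℂ, (c = 1 ∨ c = -1) ∧ pauli a * pauli b = c • (pauli b * pauli a) := by
  have h : pauli a * pauli b = pauli b * pauli a ∨ pauli a * pauli b = -(pauli b * pauli a) := by
    fin_cases a <;> fin_cases b <;> simp [pauli]
  rcases h with h | h
  · exact ⟨1, Or.inl rfl, by rw [h, one_smul]⟩
  · exact ⟨-1, Or.inr rfl, by rw [h, neg_one_smul]⟩

theorem trace_pauli_mul (a b : Fin 4) :
    (pauli a * pauli b).trace = if a = b then 2 else 0 := by
  fin_cases a <;> fin_cases b <;> simp [pauli, Matrix.trace, Fin.sum_univ_two] <;> norm_num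

theorem isPauliFamily_pauliString : IsPauliFamily (pauliString (n := n)) where
  conjTranspose_eq P := by
    change (qubitTensor fun i => pauli (P i))ᴴ = _
    simp only [qubitTensor_conjTranspose, pauli_conjTranspose]
    rfl
  mul_self P := by
    change qubitTensor (fun i => pauli (P i)) * qubitTensor (fun i => pauli (P i)) = 1
    simp only [qubitTensor_mul, pauli_mul_self, qubitTensor_one]
  comm P Q := by
    change qubitTensor (fun i => pauli (P i)) * qubitTensor (fun i => pauli (Q i)) =
      qubitTensor (fun i => pauli (Q i)) * qubitTensor (fun i => pauli (P i)) ∨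
      qubitTensor (fun i => pauli (P i)) * qubitTensor (fun i => pauli (Q i)) =
      -(qubitTensor (fun i => pauli (Q i)) * qubitTensor (fun i => pauli (P i)))
    choose c hc hPQ using fun i => exists_pauli_mul_comm (P i) (Q i)
    have hprod : ∏ i, c i = 1 ∨ ∏ i, c i = -1 := by
      refine Finset.prod_induction c (fun z => z = 1 ∨ z = -1) ?_ (Or.inl rfl) fun i _ => hc i
      rintro _ _ (rfl | rfl) (rfl | rfl) <;> simp
    simp only [qubitTensor_mul, hPQ, qubitTensor_smul]
    refine hprod.imp (fun h => by rw [h, one_smul]) (fun h => by rw [h, neg_one_smul])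

theorem pauliString_zero : pauliString (0 : Fin n → Fin 4) = 1 :=
  qubitTensor_one

theorem trace_pauliString_mul (P Q : Fin n → Fin 4) :
    (pauliString P * pauliString Q).trace = if P = Q then 2 ^ n else 0 := by
  change (qubitTensor (fun i => pauli (P i)) * qubitTensor (fun i => pauli (Q i))).trace = _
  simp [qubitTensor_mul, trace_qubitTensor, trace_pauli_mul, Finset.prod_ite_zero, funext_iff]

end PauliStrings

/-! ### Pure states -/

section PureStates

variable {e : Type*} [Fintype e] [DecidableEq e]

theorem applyOp_apply (A : Matrix e e ℂ) (φ : EuclideanSpace ℂ e) (x : e) :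
    applyOp A φ x = ∑ y, A x y * φ y := rfl

theorem applyOp_mul (A B : Matrix e e ℂ) (φ : EuclideanSpace ℂ e) :
    applyOp (A * B) φ = applyOp A (applyOp B φ) := by
  simp [applyOp]

theorem applyOp_one (φ : EuclideanSpace ℂ e) : applyOp 1 φ = φ := by
  simp [applyOp]

theorem applyOp_sub (A B : Matrix e e ℂ) (φ : EuclideanSpace ℂ e) :
    applyOp (A - B) φ = applyOp A φ - applyOp B φ := by
  simp [applyOp]

theorem inner_applyOp (A : Matrix e e ℂ) (φ χ : EuclideanSpace ℂ e) :
    ⟪applyOp A φ, χ⟫_ℂ = ⟪φ, applyOp Aᴴ χ⟫_ℂ := by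
  rw [applyOp, applyOp, Matrix.toEuclideanLin_conjTranspose_eq_adjoint,
    LinearMap.adjoint_inner_right]

theorem norm_applyOp {A : Matrix e e ℂ} (hA : Aᴴ * A = 1) (φ : EuclideanSpace ℂ e) :
    ‖applyOp A φ‖ = ‖φ‖ := by
  have h : ⟪applyOp A φ, applyOp A φ⟫_ℂ = ⟪φ, φ⟫_ℂ := by
    rw [inner_applyOp, ← applyOp_mul, hA, applyOp_one]
  rw [@norm_eq_sqrt_re_inner ℂ, h, ← @norm_eq_sqrt_re_inner ℂ]

theorem jump_pureState (A : Matrix e e ℂ) (φ : EuclideanSpace ℂ e) :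
    jump A (pureState φ) = pureState (applyOp A φ) := by
  ext x y
  simp only [jump_apply, Matrix.mul_apply, pureState, Matrix.of_apply, applyOp_apply,
    Matrix.conjTranspose_apply, star_sum, star_mul', Finset.mul_sum, Finset.sum_mul]
  rw [Finset.sum_comm]
  refine Finset.sum_congr rfl fun i _ => Finset.sum_congr rfl fun j _ => ?_
  ring

theorem trace_pureState_mul (φ : EuclideanSpace ℂ e) (A : Matrix e e ℂ) :
    (pureState φ * A).trace = ⟪φ, applyOp A φ⟫_ℂ := by
  simp only [Matrix.trace, Matrix.diag_apply, Matrix.mul_apply, pureState, Matrix.of_apply,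
    PiLp.inner_apply, applyOp_apply, RCLike.inner_apply, Finset.sum_mul]
  rw [Finset.sum_comm]
  refine Finset.sum_congr rfl fun i _ => Finset.sum_congr rfl fun j _ => ?_
  simp only [starRingEnd_apply]
  ring

theorem outcomeProb_pureState (φ : EuclideanSpace ℂ e) (A : Matrix e e ℂ) :
    outcomeProb (pureState φ) A = (⟪φ, applyOp A φ⟫_ℂ).re := by
  rw [outcomeProb, trace_pureState_mul]

theorem isDensityMatrix_pureState {φ : EuclideanSpace ℂ e} (hφ : ‖φ‖ = 1) :
    IsDensityMatrix (pureState φ) := by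
  refine ⟨Matrix.posSemidef_vecMulVec_self_star φ.ofLp, ?_⟩
  rw [← mul_one (pureState φ), trace_pureState_mul, applyOp_one, inner_self_eq_norm_sq_to_K, hφ]
  simp

/-- For a unitary the first term of the variance is one, and the squared expectation is only
subtracted. -/
theorem sum_variance_le {ι : Type*} [Fintype ι] {A : ι → Matrix e e ℂ}
    (hA : ∀ i, (A i)ᴴ * A i = 1) {φ : EuclideanSpace ℂ e} (hφ : ‖φ‖ = 1) :
    ∑ i, variance φ (A i) ≤ Fintype.card ι := by
  have h : ∀ i, variance φ (A i) ≤ 1 := fun i => by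
    rw [variance, norm_applyOp (hA i), hφ, one_pow]
    exact sub_le_self _ (sq_nonneg _)
  simpa using Finset.sum_le_sum fun i (_ : i ∈ Finset.univ) => h i

/-! ### The projection onto the noisy subspace -/

variable {κ : Type*} (Ln : κ → Matrix e e ℂ) (ψ : EuclideanSpace ℂ e)

theorem applyOp_noisyProjection (φ : EuclideanSpace ℂ e) :
    applyOp (noisyProjection Ln ψ) φ =
      (Submodule.span ℂ (insert ψ (Set.range fun k => applyOp (Ln k) ψ))).starProjection φ := by
  rw [applyOp, ← Matrix.coe_toEuclideanCLM_eq_toEuclideanLin, noisyProjection]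
  simp

theorem isPOVM_noisyMeasurement : IsPOVM (noisyMeasurement Ln ψ) := by
  set P := noisyProjection Ln ψ with hP
  have hstar : Pᴴ = P := by
    rw [← Matrix.star_eq_conjTranspose, hP, noisyProjection]
    refine (map_star (Matrix.toEuclideanCLM (n := e) (𝕜 := ℂ)).symm _).symm.trans ?_
    congr 1
    exact (isSelfAdjoint_starProjection _).star_eq
  have hmul : P * P = P := by
    rw [hP, noisyProjection, ← map_mul]
    congr 1
    exact (Submodule.isIdempotentElem_starProjection _).eq
  have h1 : P = Pᴴ * P := by rw [hstar, hmul]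
  have h2 : 1 - P = (1 - P)ᴴ * (1 - P) := by
    rw [Matrix.conjTranspose_sub, Matrix.conjTranspose_one, hstar, mul_sub, sub_mul, sub_mul, hmul]
    simp
  refine ⟨fun x => ?_, by rw [Fintype.sum_bool]; exact add_sub_cancel _ _⟩
  cases x
  · change (1 - P).PosSemidef
    rw [h2]
    exact Matrix.posSemidef_conjTranspose_mul_self _
  · change P.PosSemidef
    rw [h1]
    exact Matrix.posSemidef_conjTranspose_mul_self _

variable {Ln ψ} {φ : EuclideanSpace ℂ e}

theorem outcomeProb_noisy_of_mem
    (h : φ ∈ insert ψ (Set.range fun k => applyOp (Ln k) ψ)) :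
    outcomeProb (pureState φ) (noisyMeasurement Ln ψ false) = 0 := by
  rw [outcomeProb_pureState, noisyMeasurement, applyOp_sub, applyOp_one, applyOp_noisyProjection,
    Submodule.starProjection_eq_self_iff.2 (Submodule.subset_span h), sub_self, inner_zero_right,
    Complex.zero_re]

theorem outcomeProb_noisy_of_orthogonal (hφ : ‖φ‖ = 1) (h0 : ⟪ψ, φ⟫_ℂ = 0)
    (h : ∀ k, ⟪applyOp (Ln k) ψ, φ⟫_ℂ = 0) :
    outcomeProb (pureState φ) (noisyMeasurement Ln ψ false) = 1 := by
  have hmem : φ ∈ (Submodule.span ℂ (insert ψ (Set.range fun k => applyOp (Ln k) ψ)))ᗮ := by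
    rw [Submodule.mem_orthogonal]
    intro u hu
    induction hu using Submodule.span_induction with
    | mem x hx =>
      rcases hx with rfl | ⟨k, rfl⟩
      · exact h0
      · exact h k
    | zero => exact inner_zero_left _
    | add x y _ _ hx hy => rw [inner_add_left, hx, hy, add_zero]
    | smul c x _ hx => rw [inner_smul_left, hx, mul_zero]
  rw [outcomeProb_pureState, noisyMeasurement, applyOp_sub, applyOp_one, applyOp_noisyProjection,
    (Submodule.starProjection_apply_eq_zero_iff _).2 hmem, sub_zero, inner_self_eq_norm_sq_to_K, hφ]
  simp

end PureStates

/-! ### Bell states -/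

section Bell

variable {d : Type*} [Fintype d] [DecidableEq d]
  (b : OrthonormalBasis d ℂ (EuclideanSpace ℂ d))

/-- The matrix of coefficients of the unnormalised Bell state. -/
noncomputable def bellMatrix : Matrix d d ℂ :=
  Matrix.of fun x y => ∑ j, b j x * b j y

/-- The matrix is `U * Uᵀ`, where the columns of the unitary `U` are the basis vectors; it depends
on the basis but is always unitary. -/
theorem bellMatrix_mul_conjTranspose : bellMatrix b * (bellMatrix b)ᴴ = 1 := by
  let U : Matrix d d ℂ := Matrix.of fun x j => b j x
  have hU : U * Uᴴ = 1 := by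
    ext x y
    have h := b.sum_inner_mul_inner (EuclideanSpace.single x 1) (EuclideanSpace.single y 1)
    simp only [EuclideanSpace.inner_single_left, EuclideanSpace.inner_single_right] at h
    simpa [U, Matrix.mul_apply, Matrix.one_apply, Pi.single_apply, eq_comm] using h
  have hU' : Uᴴ * U = 1 := mul_eq_one_comm.1 hU
  have hB : bellMatrix b = U * Uᵀ := by
    ext x y
    simp [bellMatrix, U, Matrix.mul_apply]
  have hT : Uᵀ * (Uᵀ)ᴴ = 1 := by
    have h := congrArg Matrix.transpose hU'
    rwa [Matrix.transpose_mul, Matrix.transpose_one] at h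
  rw [hB, Matrix.conjTranspose_mul, Matrix.mul_assoc, ← Matrix.mul_assoc Uᵀ, hT, one_mul, hU]

theorem applyOp_bellState (A : Matrix d d ℂ) (x : d × d) :
    applyOp (withAncilla d A) (bellState b) x =
      (1 / (Real.sqrt (Fintype.card d) : ℂ)) * (A * bellMatrix b) x.1 x.2 := by
  rw [applyOp_apply, Fintype.sum_prod_type, Matrix.mul_apply, Finset.mul_sum]
  refine Finset.sum_congr rfl fun y _ => ?_
  rw [Finset.sum_eq_single x.2]
  · simp [withAncilla, bellState, bellMatrix]
    ring
  · intro z _ hz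
    simp [withAncilla, hz.symm]
  · simp

/-- The vector `(A ⊗ I) ψ` has coefficient matrix `A * bellMatrix b` up to normalisation, and the
unitary factor drops out of the trace. So the inner product is the normalised Hilbert–Schmidt one
for every basis. -/
theorem inner_applyOp_bellState (A B : Matrix d d ℂ) :
    ⟪applyOp (withAncilla d A) (bellState b), applyOp (withAncilla d B) (bellState b)⟫_ℂ =
      (Fintype.card d : ℂ)⁻¹ * (Aᴴ * B).trace := by
  have hs : ((Real.sqrt (Fintype.card d) : ℝ) : ℂ)⁻¹ * ((Real.sqrt (Fintype.card d) : ℝ) : ℂ)⁻¹ =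
      (Fintype.card d : ℂ)⁻¹ := by
    rw [← mul_inv, ← Complex.ofReal_mul, Real.mul_self_sqrt (Nat.cast_nonneg _),
      Complex.ofReal_natCast]
  have htr : (Aᴴ * B).trace = ((A * bellMatrix b)ᴴ * (B * bellMatrix b)).trace := by
    rw [Matrix.conjTranspose_mul, Matrix.mul_assoc, Matrix.trace_mul_comm (bellMatrix b)ᴴ,
      Matrix.mul_assoc, Matrix.mul_assoc, bellMatrix_mul_conjTranspose, mul_one]
  rw [htr, ← hs, PiLp.inner_apply, Fintype.sum_prod_type, Matrix.trace, Finset.mul_sum,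
    Finset.sum_comm]
  refine Finset.sum_congr rfl fun y _ => ?_
  rw [Matrix.diag_apply, Matrix.mul_apply, Finset.mul_sum]
  refine Finset.sum_congr rfl fun x _ => ?_
  rw [RCLike.inner_apply, applyOp_bellState, applyOp_bellState, Matrix.conjTranspose_apply,
    starRingEnd_apply, star_mul']
  simp
  ring

variable {n : ℕ}
  (b : OrthonormalBasis (Fin n → Fin 2) ℂ (EuclideanSpace ℂ (Fin n → Fin 2)))

theorem orthonormal_pauli_bellState :
    Orthonormal ℂ fun P => applyOp (withAncilla (Fin n → Fin 2) (pauliString P)) (bellState b) := by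
  rw [orthonormal_iff_ite]
  intro P Q
  rw [inner_applyOp_bellState, isPauliFamily_pauliString.conjTranspose_eq, trace_pauliString_mul]
  split_ifs <;> simp

theorem applyOp_pauliString_zero (φ : EuclideanSpace ℂ ((Fin n → Fin 2) × (Fin n → Fin 2))) :
    applyOp (withAncilla (Fin n → Fin 2) (pauliString 0)) φ = φ := by
  rw [pauliString_zero, withAncilla, Matrix.one_kronecker_one, applyOp_one]

end Bell

/-! ### Main theorem -/

/-- The fast-control limit has the same value at every `θ ≠ 0`, so the vanishing-signal limit is
that of a constant. -/
theorem HasFastControlVanishingSignalLimit.of_forall {F : ℝ → ℕ → ℝ≥0∞} {v : ℝ}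
    (h : ∀ θ ≠ 0, Tendsto (F θ) atTop (𝓝 (ENNReal.ofReal v))) :
    HasFastControlVanishingSignalLimit F v :=
  ⟨fun _ => ENNReal.ofReal v,
    eventually_mem_nhdsWithin.mono fun θ (hθ : 0 < θ) => h θ hθ.ne', tendsto_const_nhds⟩

theorem mainTheorem4 (n : ℕ) (S N : Finset (Fin n → Fin 4))
    (hS : (0 : Fin n → Fin 4) ∉ S) (hN : (0 : Fin n → Fin 4) ∉ N) (hSN : Disjoint S N)
    (γ : N → ℝ) (hγ : ∀ k, 0 < γ k) (T : ℝ) (hT : 0 < T)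
    (b : OrthonormalBasis (Fin n → Fin 2) ℂ (EuclideanSpace ℂ (Fin n → Fin 2))) :
    let Ls : S → Matrix (Fin n → Fin 2) (Fin n → Fin 2) ℂ := fun P => pauliString P.1
    let Ln : N → Matrix (Fin n → Fin 2) (Fin n → Fin 2) ℂ := fun P => pauliString P.1
    let ψ : EuclideanSpace ℂ ((Fin n → Fin 2) × (Fin n → Fin 2)) := bellState b
    let L' := fun P : Fin n → Fin 4 => withAncilla (Fin n → Fin 2) (pauliString P)
    let E := noisyMeasurement (fun k : N => L' k.1) ψ
    let v : ℝ := 4 * S.card * T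
    -- the optimal noiseless QFI with fast and precise control is `4 K T`
    HasFastControlVanishingSignalLimit
      (sequentialQFI Ls (Fin.elim0 : Fin 0 → Matrix _ _ ℂ) Fin.elim0 T) v ∧
    -- and it is the maximum of `4 T` times the sum of the variances of the signal operators
    IsGreatest {x : ℝ | ∃ (α : Type) (_ : Fintype α) (_ : DecidableEq α)
      (φ : EuclideanSpace ℂ ((Fin n → Fin 2) × α)), ‖φ‖ = 1 ∧
        x = 4 * T * ∑ j, variance φ (withAncilla α (Ls j))} v ∧
    -- the noisy measure-and-reset strategy with a Bell state recovers it
    HasFastControlVanishingSignalLimit (measureResetQFI Ls Ln γ T ψ) v ∧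
    -- already when only the projection onto the noisy subspace is measured
    IsPOVM E ∧ HasFastControlVanishingSignalLimit (measureResetFisherInfo Ls Ln γ T ψ E) v ∧
    4 * T * ∑ j : S, outcomeProb (pureState (applyOp (L' j.1) ψ)) (E false) = v ∧
    -- the Bell state (`P = 0`) and its Pauli images are pairwise orthogonal unit vectors
    Orthonormal ℂ (fun P => applyOp (L' P) ψ) := by
  intro Ls Ln ψ L' E v
  have horth : Orthonormal ℂ fun P => applyOp (L' P) ψ := orthonormal_pauli_bellState b
  have hL0 : applyOp (L' 0) ψ = ψ := applyOp_pauliString_zero ψ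
  have hψ : ‖ψ‖ = 1 := by
    rw [← hL0]
    exact horth.1 0
  have hdens := isDensityMatrix_pureState hψ
  have hinner : ∀ P, P ≠ 0 → ⟪ψ, applyOp (L' P) ψ⟫_ℂ = 0 := fun P hP => by
    have h := horth.2 hP.symm
    dsimp only at h
    rwa [hL0] at h
  have hE : IsPOVM E := isPOVM_noisyMeasurement _ _
  have hS0 : ∀ j : S, (j : Fin n → Fin 4) ≠ 0 := fun j h => hS (h ▸ j.2)
  -- The noise labels are left general, so that the claim serves both the noisy case and the
  -- noiseless one with labels in `Fin 0`.
  have hsignal : ∀ {N' : Type} (f : N' → Fin n → Fin 4), (∀ k, f k ∉ S) → ∀ j : S,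
      outcomeProb (pureState (applyOp (L' j) ψ)) (noisyMeasurement (fun k => L' (f k)) ψ false)
        = 1 := fun f hf j =>
    outcomeProb_noisy_of_orthogonal (horth.1 j) (hinner j (hS0 j))
      fun k => horth.2 fun h => hf k (h ▸ j.2)
  have hnotMem : ∀ k : N, (k : Fin n → Fin 4) ∉ S := fun k h =>
    Finset.disjoint_left.1 hSN h k.2
  have hfam : IsPauliFamily (Sum.elim Ls Ln) := by
    convert isPauliFamily_pauliString.comp (Sum.elim (fun P : S => P.1) (fun P : N => P.1)) using 1
    funext x
    cases x <;> rfl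
  have hfam0 : IsPauliFamily (Sum.elim Ls (Fin.elim0 : Fin 0 → Matrix _ _ ℂ)) := by
    convert isPauliFamily_pauliString.comp (Sum.elim (fun P : S => P.1)
      (Fin.elim0 : Fin 0 → Fin n → Fin 4)) using 1
    funext x
    rcases x with x | x
    · rfl
    · exact x.elim0
  have hv : v = 4 * Fintype.card S * T := by rw [Fintype.card_coe]
  have hFE : ∀ θ ≠ 0, Tendsto (measureResetFisherInfo Ls Ln γ T ψ E θ) atTop
      (𝓝 (ENNReal.ofReal v)) := fun θ hθ => by
    rw [hv]
    refine tendsto_measureResetFisherInfo hfam (fun k => (hγ k).le) hT hdens hE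
      (outcomeProb_noisy_of_mem (Set.mem_insert _ _)) (fun j => ?_) (fun k => ?_) hθ
    · rw [jump_pureState]
      exact hsignal _ hnotMem j
    · rw [jump_pureState]
      exact outcomeProb_noisy_of_mem (Set.mem_insert_of_mem _ ⟨k, rfl⟩)
  refine ⟨?_, ⟨?_, ?_⟩, ?_, hE, .of_forall hFE, ?_, horth⟩
  · refine .of_forall fun θ hθ => ?_
    -- Without noise the noisy subspace is the line through `ψ`, so this measurement asks whether
    -- the state is still `ψ`.
    let E₀ := noisyMeasurement (fun k : Fin 0 => L' (Fin.elim0 k)) ψ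
    have hE₀ : IsPOVM E₀ := isPOVM_noisyMeasurement _ _
    have hlow := tendsto_measureResetFisherInfo hfam0 (γ := Fin.elim0) (fun k => k.elim0) hT hdens
      hE₀ (outcomeProb_noisy_of_mem (Set.mem_insert _ _)) (fun j => by
        rw [jump_pureState]
        exact hsignal _ (fun k => k.elim0) j) (fun k => k.elim0) hθ
    rw [← hv] at hlow
    refine tendsto_of_tendsto_of_tendsto_of_le_of_le' hlow tendsto_const_nhds
      (Eventually.of_forall fun M => measureResetFisherInfo_le_sequentialQFI hfam0
        (fun k => k.elim0) hT.le hdens hE₀ θ M) ?_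
    filter_upwards [eventually_ne_atTop 0] with M hM
    rw [hv]
    exact sequentialQFI_le hfam0 (fun k => k.elim0) hT.le hθ hM
  · refine ⟨Fin n → Fin 2, inferInstance, inferInstance, ψ, hψ, ?_⟩
    have hvar : ∀ j : S, variance ψ (withAncilla (Fin n → Fin 2) (Ls j)) = 1 := fun j => by
      have h1 : ‖applyOp (withAncilla (Fin n → Fin 2) (Ls j)) ψ‖ = 1 := horth.1 j
      have h2 : ⟪ψ, applyOp (withAncilla (Fin n → Fin 2) (Ls j)) ψ⟫_ℂ = 0 := hinner j (hS0 j)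
      rw [variance, h1, h2]
      simp
    simp only [hvar, Finset.sum_const, Finset.card_univ, Fintype.card_coe, nsmul_eq_mul, mul_one, v]
    ring
  · rintro x ⟨α, _, _, φ, hφ, rfl⟩
    have h := sum_variance_le
      (((hfam.comp Sum.inl).withAncilla α).conjTranspose_mul_self) hφ
    rw [hv]
    have h2 := mul_le_mul_of_nonneg_left h (show 0 ≤ 4 * T by positivity)
    refine h2.trans_eq ?_
    ring
  · refine .of_forall fun θ hθ => ?_
    refine tendsto_of_tendsto_of_tendsto_of_le_of_le' (hFE θ hθ) tendsto_const_nhds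
      (Eventually.of_forall fun M => measureResetFisherInfo_le_measureResetQFI _ _ _ _ _ hE _ _) ?_
    filter_upwards [eventually_ne_atTop 0] with M hM
    rw [hv]
    exact iSup_le fun m => iSup_le fun E' => iSup_le fun hE' =>
      measureResetFisherInfo_le hfam (fun k => (hγ k).le) hT.le hdens hE' hθ hM
  · have h1 : ∀ j : S, outcomeProb (pureState (applyOp (L' j.1) ψ)) (E false) = 1 :=
      hsignal _ hnotMem
    simp only [h1, Finset.sum_const, Finset.card_univ, Fintype.card_coe, nsmul_eq_mul, mul_one, v]
    ring
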